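/- Let $q$ be a power of a prime $p>2$, let $A=\mathbb{F}_q[t]$, $k=\mathbb{F}_q(t)$, and let $k_\infty=\mathbb{F}_q((1/t))$ be the completion of $k$ at infinity, with the absolute value $\left|\sum_{i\le n}a_it^i\right|_\infty=q^n$ if $a_n\neq 0$, and the additive character $$e\Big(\sum_{i\le n}a_it^i\Big)=\exp\Big(\frac{2\pi i}{p}\,\mathrm{Tr}_{\mathbb{F}_q/\mathbb{F}_p}(a_{-1})\Big).$$ Let $\alpha\in A$ be a square-free polynomial which is of odd degree or whose leading coefficient is not a square in $\mathbb{F}_q$. Let $K=k(\sqrt{\alpha})$, let $\mathbb{A}$ be the integral closure of $A$ in $K$, and let $\mathbf{Tr}:K\to k$ be the trace map. Let $|\cdot|_\infty$ also denote the extension of $|\cdot|_\infty$ from $k$ to $K$ and write $\mathbf{N}(f)=|f|_\infty^2$. Then for all integers $Q,N\ge 0$ and every family $(a_g)_{g\in\mathbb{A}}$ of complex numbers, all the sums below are finite and $$ \sum_{\substack{f\in\mathbb{A}\setminus\{0\}\\ \mathbf{N}(f)=q^Q}}\ \sum_{\substack{r\bmod f^2\\ (r,f)=1}}\Bigg|\sum_{\substack{g\in\mathbb{A}\\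 \mathbf{N}(g)\le q^N}}a_g\, e\Big(\mathbf{Tr}\Big(\frac{gr}{2\sqrt{\alpha}\,f^2}\Big)\Big)\Bigg|^2 \le C\Big(q^{3Q}+2^{(N-Q)/2}\big(q^{Q/2+N}+q^{2Q+N/2}\big)\Big)\sum_{\substack{g\in\mathbb{A}\\ \mathbf{N}(g)\le q^N}}|a_g|^2, $$ where $(r,f)=1$ means that $r$ and $f$ generate the unit ideal of $\mathbb{A}$, and the constant $C>0$ depends only on $q$ and $\deg\alpha$. -/

import Mathlib

open Polynomial

noncomputable section

namespace SquareSieve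

/-- The inclusion `F[t] → F((1/t))`. An element of `LaurentSeries F` is read as a Laurent series in
the variable `1/t`, so that its coefficient with index `i` is the coefficient of `t ^ (-i)`; in
particular `t` itself is the monomial of index `-1`. -/
def polyToKInf (F : Type*) [Field F] : F[X] →+* LaurentSeries F :=
  Polynomial.eval₂RingHom HahnSeries.C (HahnSeries.single (-1) 1)

theorem polyToKInf_coeff {F : Type*} [Field F] (f : F[X]) (n : ℕ) :
    (polyToKInf F f).coeff (-(n : ℤ)) = f.coeff n := by
  induction f using Polynomial.induction_on' with
  | add f g hf hg => rw [map_add, HahnSeries.coeff_add, hf, hg, Polynomial.coeff_add]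
  | monomial m a =>
    have h : polyToKInf F (monomial m a) = HahnSeries.single (-(m : ℤ)) a := by
      simp [polyToKInf, HahnSeries.C_apply, HahnSeries.single_pow, HahnSeries.single_mul_single]
    rw [h, HahnSeries.coeff_single, Polynomial.coeff_monomial]
    simp [eq_comm]

theorem polyToKInf_injective (F : Type*) [Field F] : Function.Injective (polyToKInf F) := by
  intro f g h
  ext n
  rw [← polyToKInf_coeff f n, ← polyToKInf_coeff g n, h]

/-- The inclusion of `k = F(t)` into its completion `k_∞ = F((1/t))` at infinity. -/
def toKInf (F : Type*) [Field F] : RatFunc F →+* LaurentSeries F :=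
  IsFractionRing.lift (A := F[X]) (polyToKInf_injective F)

/-- The absolute value on `k_∞ = F((1/t))`: `|∑_{i ≤ n} a_i t^i| = q ^ n` if `a_n ≠ 0`. -/
def absInf {F : Type*} [Field F] (x : LaurentSeries F) : ℝ :=
  open Classical in if x = 0 then 0 else (Nat.card F : ℝ) ^ (-x.order)

/-- The additive character `E(x) = exp (2πi/p · Tr x)` of the finite field `F`, where `p` is the
characteristic and `Tr : F → 𝔽_p` is the trace. -/
def charE {F : Type*} [Field F] (x : F) : ℂ :=
  letI : Algebra (ZMod (ringChar F)) F := ZMod.algebra F (ringChar F)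
  Complex.exp (2 * Real.pi * Complex.I / (ringChar F : ℂ) *
    ((Algebra.trace (ZMod (ringChar F)) F x).val : ℂ))

/-- The additive character `e(∑ a_i t^i) = E(a_{-1})` of `k_∞`. -/
def charInf {F : Type*} [Field F] (x : LaurentSeries F) : ℂ :=
  charE (x.coeff 1)

section Extension

variable {F K : Type*} [Field F] [Field K] [Algebra F[X] K]

/-- The nonzero `f` in the integral closure `𝔸` of `F[t]` in `K` with `𝐍(f) = |f|² = q ^ Q`. -/
def moduli (v : AbsoluteValue K ℝ) (Q : ℕ) : Set (integralClosure F[X] K) :=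
  {f | f ≠ 0 ∧ v (f : K) ^ 2 = (Nat.card F : ℝ) ^ Q}

/-- The set `𝐁(0, N) ∩ 𝔸` of the integers `g` with `𝐍(g) = |g|² ≤ q ^ N`. -/
def ballInt (v : AbsoluteValue K ℝ) (N : ℕ) : Set (integralClosure F[X] K) :=
  {g | v (g : K) ^ 2 ≤ (Nat.card F : ℝ) ^ N}

/-- The exponential sum `∑_{g ∈ 𝐁(0, N) ∩ 𝔸} a_g e(Tr(g r / (2 s f²)))`, where `s` is the chosen
square root of `α`. -/
def expSum [Algebra (RatFunc F) K] (v : AbsoluteValue K ℝ) (s : K) (N : ℕ)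
    (a : integralClosure F[X] K → ℂ) (f r : integralClosure F[X] K) : ℂ :=
  ∑ᶠ g ∈ ballInt v N,
    a g * charInf (toKInf F (Algebra.trace (RatFunc F) K
      ((g : K) * (r : K) / (2 * s * (f : K) ^ 2))))

/-- The left-hand side of the large sieve with square moduli. The sum over `r mod f²` runs over the
residue classes `c`, each with a representative `c.out`; neither coprimality to `f` nor the
exponential sum depends on the representative. -/
def sieveSum [Algebra (RatFunc F) K] (v : AbsoluteValue K ℝ) (s : K) (Q N : ℕ)
    (a : integralClosure F[X] K → ℂ) : ℝ :=
  ∑ᶠ f ∈ moduli v Q,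
    ∑ᶠ c ∈ {c : integralClosure F[X] K ⧸ Ideal.span {f ^ 2} | IsCoprime c.out f},
      ‖expSum v s N a f c.out‖ ^ 2

end Extension

end SquareSieve

end

set_option linter.unusedSectionVars false

noncomputable section
namespace SquareSieve

/-! ### Laurent series in `1/t` and the norm form `a² - α b²`. -/

section Laurent

variable {F : Type*} [Field F]

/-! The integers `g` with `𝐍(g) ≤ q^N` form a finite group `G` of order at most `q^(N+2)`, and every
fraction `r/f²` defines a character of `G`. Parseval over all characters of `G`
(`sum_norm_sq_le_of_card_fiber_le`) bounds the left side by `B |G| ∑ |a_g|²`, where `B` bounds the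
number of pairs `(f, r)` that share one character. What remains is to bound this multiplicity.

The condition on `α` excludes cancellation in `a² - α b²`, so `v` is an explicit maximum over the
coordinates in the basis `1, √α` (`abs_sq_add_mul`); balls and unit groups of `𝔸` are therefore
finite. The functional `Tr(·/(2√α))` reads off the `√α`-coordinate, so two fractions with the same
character differ from an integer by an error with `𝐍 ≤ q^(d-N)`, where `d = deg α`
(`exists_abs_sub_sq_le`). Thus if `r/f²` shares the character of `x = r₀/f₀²`, then `f² x` is within
`q^(2Q+d-N)` of an integer, and each `f` admits `O(1 + q^(2Q-N))` classes `r`.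

If `N ≤ 2Q`, counting all `O(q^Q)` moduli already gives `q^(3Q)`. If `N ≥ 2Q`, the moduli are
counted by square differencing (`card_sq_le`). For two admissible moduli, `m = f₁² - f₂²` also makes
`m x` nearly integral. As `r₀` is invertible modulo `f₀²`, there are only `O(1 + q^(4Q-N))` such `m`
(`ncard_multipliers_le`), and a nonzero `m` arises from at most as many pairs as it has divisors,
which is `O(2^Q)` (`ncard_divisors_le`). Hence there are `O(2^(Q/2) (1 + q^(2Q-N/2)))` moduli, and
`2^(Q/2) ≤ 2^((N-Q)/2)` in this range. -/

theorem polyToKInf_coeff_pos (f : F[X]) {i : ℤ} (hi : 0 < i) : (polyToKInf F f).coeff i = 0 := by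
  induction f using Polynomial.induction_on' with
  | add f g hf hg => rw [map_add, HahnSeries.coeff_add, hf, hg, add_zero]
  | monomial m a =>
    have h : polyToKInf F (monomial m a) = HahnSeries.single (-(m : ℤ)) a := by
      simp [polyToKInf, HahnSeries.C_apply, HahnSeries.single_pow, HahnSeries.single_mul_single]
    rw [h, HahnSeries.coeff_single_of_ne (by omega)]

theorem absInf_zero : absInf (0 : LaurentSeries F) = 0 := by simp [absInf]

theorem absInf_of_ne_zero {x : LaurentSeries F} (hx : x ≠ 0) :
    absInf x = (Nat.card F : ℝ) ^ (-x.order) := by simp [absInf, hx]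

theorem toKInf_algebraMap (p : F[X]) : toKInf F (algebraMap F[X] (RatFunc F) p) = polyToKInf F p :=
  IsFractionRing.lift_algebraMap _ _

theorem order_polyToKInf {p : F[X]} (hp : p ≠ 0) :
    (polyToKInf F p).order = -(p.natDegree : ℤ) := by
  have h0 : polyToKInf F p ≠ 0 := by
    rwa [Ne, map_eq_zero_iff _ (polyToKInf_injective F)]
  apply le_antisymm
  · apply HahnSeries.order_le_of_coeff_ne_zero
    rw [polyToKInf_coeff]
    simpa using hp
  · by_contra! h
    have h1 : (polyToKInf F p).coeff (polyToKInf F p).order ≠ 0 := HahnSeries.coeff_order_eq_zero.not.mpr h0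
    obtain ⟨n, hn⟩ : ∃ n : ℕ, (polyToKInf F p).order = -(n : ℤ) :=
      ⟨(-(polyToKInf F p).order).toNat, by omega⟩
    rw [hn, polyToKInf_coeff] at h1
    have := Polynomial.le_natDegree_of_ne_zero h1
    omega

/-- The integer part of a Laurent series in `1/t`. -/
theorem exists_coeff_sub_polyToKInf_eq_zero (x : LaurentSeries F) :
    ∃ p : F[X], ∀ i : ℤ, i ≤ 0 → (x - polyToKInf F p).coeff i = 0 := by
  refine ⟨∑ n ∈ Finset.range ((-x.order).toNat + 1), monomial n (x.coeff (-(n : ℤ))), fun i hi => ?_⟩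
  obtain ⟨n, rfl⟩ : ∃ n : ℕ, i = -(n : ℤ) := ⟨(-i).toNat, by omega⟩
  rw [HahnSeries.coeff_sub, polyToKInf_coeff, Polynomial.finsetSum_coeff]
  simp only [Polynomial.coeff_monomial, Finset.sum_ite_eq', Finset.mem_range]
  split_ifs with h
  · exact sub_self _
  · rw [sub_zero]
    apply HahnSeries.coeff_eq_zero_of_lt_order
    omega

theorem absInf_polyToKInf {p : F[X]} (hp : p ≠ 0) :
    absInf (polyToKInf F p) = (Nat.card F : ℝ) ^ p.natDegree := by
  have h0 : polyToKInf F p ≠ 0 := by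
    rwa [Ne, map_eq_zero_iff _ (polyToKInf_injective F)]
  rw [absInf_of_ne_zero h0, order_polyToKInf hp, neg_neg, zpow_natCast]

theorem absInf_nonneg (x : LaurentSeries F) : 0 ≤ absInf x := by
  unfold absInf
  split_ifs <;> positivity

theorem absInf_neg (x : LaurentSeries F) : absInf (-x) = absInf x := by
  by_cases hx : x = 0
  · rw [hx, neg_zero]
  · rw [absInf_of_ne_zero hx, absInf_of_ne_zero (neg_ne_zero.mpr hx), HahnSeries.order_neg]

variable [Finite F]

theorem one_lt_card : (1 : ℝ) < Nat.card F := by exact_mod_cast Finite.one_lt_card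

theorem absInf_mul (x y : LaurentSeries F) : absInf (x * y) = absInf x * absInf y := by
  by_cases hx : x = 0
  · simp [hx, absInf_zero]
  by_cases hy : y = 0
  · simp [hy, absInf_zero]
  have hq := one_lt_card (F := F)
  rw [absInf_of_ne_zero hx, absInf_of_ne_zero hy, absInf_of_ne_zero (mul_ne_zero hx hy),
    HahnSeries.order_mul hx hy, neg_add, zpow_add₀ (by positivity)]

/-- If `α` has odd degree or a nonsquare leading coefficient, there is no cancellation in
`a² - α b²`. -/
theorem absInf_sq_sub_mul_sq {α : F[X]} (hα : Odd α.natDegree ∨ ¬ IsSquare α.leadingCoeff)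
    (a b : LaurentSeries F) :
    absInf (a ^ 2 - polyToKInf F α * b ^ 2) =
      max (absInf a ^ 2) (absInf (polyToKInf F α) * absInf b ^ 2) := by
  have hq := one_lt_card (F := F)
  have hα0 : α ≠ 0 := by rintro rfl; simp at hα
  have hP0 : polyToKInf F α ≠ 0 := by
    rwa [Ne, map_eq_zero_iff _ (polyToKInf_injective F)]
  set P := polyToKInf F α with hP
  have hord : P.order = -(α.natDegree : ℤ) := order_polyToKInf hα0
  have hPc : P.coeff P.order = α.leadingCoeff := by
    rw [hord, hP, polyToKInf_coeff]; rfl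
  have hsq (x : LaurentSeries F) : absInf (x ^ 2) = absInf x ^ 2 := by
    rw [pow_two, pow_two, absInf_mul]
  by_cases ha : a = 0
  · subst ha
    simp only [ne_eq, OfNat.ofNat_ne_zero, not_false_eq_true, zero_pow, zero_sub, absInf_neg,
      absInf_mul, hsq, absInf_zero]
    exact (max_eq_right (mul_nonneg (absInf_nonneg _) (sq_nonneg _))).symm
  by_cases hb : b = 0
  · subst hb
    simp only [ne_eq, OfNat.ofNat_ne_zero, not_false_eq_true, zero_pow, mul_zero, sub_zero, hsq,
      absInf_zero]
    exact (max_eq_left (sq_nonneg _)).symm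
  rw [← hsq, ← hsq, ← absInf_mul]
  -- It suffices that the coefficient at the smaller of the two orders survives in the difference.
  have hlt (x y : LaurentSeries F) (hx : x ≠ 0) (hy : y ≠ 0)
      (h : (x - y).coeff (min x.order y.order) ≠ 0) :
      absInf (x - y) = max (absInf x) (absInf y) := by
    have hxy : x - y ≠ 0 := by rintro h0; simp [h0] at h
    have h1 : (x - y).order = min x.order y.order := by
      apply le_antisymm (HahnSeries.order_le_of_coeff_ne_zero h)
      have := HahnSeries.min_order_le_order_add (x := x) (y := -y) (by rwa [← sub_eq_add_neg])
      rwa [HahnSeries.order_neg, ← sub_eq_add_neg] at this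
    rw [absInf_of_ne_zero hx, absInf_of_ne_zero hy, absInf_of_ne_zero hxy, h1]
    rcases le_total x.order y.order with h | h
    · rw [min_eq_left h, max_eq_left (zpow_le_zpow_right₀ hq.le (by omega))]
    · rw [min_eq_right h, max_eq_right (zpow_le_zpow_right₀ hq.le (by omega))]
  have ha2 : a ^ 2 ≠ 0 := pow_ne_zero _ ha
  have hb2 : P * b ^ 2 ≠ 0 := mul_ne_zero hP0 (pow_ne_zero _ hb)
  have hoa : (a ^ 2).order = 2 * a.order := by
    rw [pow_two, HahnSeries.order_mul ha ha, two_mul]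
  have hob' : (b ^ 2).order = 2 * b.order := by
    rw [pow_two, HahnSeries.order_mul hb hb, two_mul]
  have hob : (P * b ^ 2).order = P.order + 2 * b.order := by
    rw [HahnSeries.order_mul hP0 (pow_ne_zero _ hb), hob']
  have hlc (x y : LaurentSeries F) :
      (x * y).coeff (x.order + y.order) = x.coeff x.order * y.coeff y.order := by
    rw [HahnSeries.coeff_mul_order_add_order, HahnSeries.leadingCoeff_eq, HahnSeries.leadingCoeff_eq]
  have hca : (a ^ 2).coeff (a ^ 2).order = a.coeff a.order ^ 2 := by
    rw [hoa, pow_two, two_mul, hlc, pow_two]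
  have hcb' : (b ^ 2).coeff (b ^ 2).order = b.coeff b.order ^ 2 := by
    rw [hob', pow_two, two_mul, hlc, pow_two]
  have hcb : (P * b ^ 2).coeff (P * b ^ 2).order = α.leadingCoeff * b.coeff b.order ^ 2 := by
    rw [hob, ← hob', hlc, hPc, hcb']
  apply hlt _ _ ha2 hb2
  rw [HahnSeries.coeff_sub]
  rcases lt_trichotomy (a ^ 2).order (P * b ^ 2).order with h | h | h
  · rw [min_eq_left h.le, HahnSeries.coeff_eq_zero_of_lt_order h, sub_zero]
    exact HahnSeries.coeff_order_eq_zero.not.mpr ha2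
  · rw [← h, min_self, hca, h, hcb]
    intro h0
    -- With equal orders, `deg α` is even; cancelling leading coefficients would then make that of
    -- `α` a square.
    rw [hoa, hob, hord] at h
    rcases hα with hα | hα
    · obtain ⟨k, hk⟩ := hα
      omega
    · apply hα
      have hb0 : b.coeff b.order ≠ 0 := HahnSeries.coeff_order_eq_zero.not.mpr hb
      refine ⟨a.coeff a.order / b.coeff b.order, ?_⟩
      field_simp
      linear_combination -h0
  · rw [min_eq_right h.le, HahnSeries.coeff_eq_zero_of_lt_order h, zero_sub, neg_ne_zero]
    exact HahnSeries.coeff_order_eq_zero.not.mpr hb2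

end Laurent

/-- `K = k(√α)` is an imaginary quadratic extension of `k = F(t)` of odd characteristic, `s` is a
square root of `α`, and `v` extends the absolute value at infinity. -/
structure IsImaginaryQuadratic {F K : Type*} [Field F] [Field K] [Algebra F[X] K]
    [Algebra (RatFunc F) K] (α : F[X]) (s : K) (v : AbsoluteValue K ℝ) : Prop where
  two_lt_ringChar : 2 < ringChar F
  squarefree : Squarefree α
  odd_or_not_isSquare : Odd α.natDegree ∨ ¬ IsSquare α.leadingCoeff
  sq_eq : s ^ 2 = algebraMap F[X] K α
  adjoin_eq_top : IntermediateField.adjoin (RatFunc F) {s} = ⊤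
  abs_algebraMap : ∀ x : RatFunc F, v (algebraMap (RatFunc F) K x) = absInf (toKInf F x)

/-- An absolute value bounded by `1` on the natural numbers is ultrametric. -/
theorem abs_add_le_max_of_natCast_le_one {K : Type*} [Field K] (v : AbsoluteValue K ℝ)
    (h : ∀ n : ℕ, v n ≤ 1) (x y : K) : v (x + y) ≤ max (v x) (v y) := by
  let _ := v.toNormedField
  have hu : IsUltrametricDist K :=
    IsUltrametricDist.isUltrametricDist_of_forall_norm_natCast_le_one h
  exact IsUltrametricDist.norm_add_le_max x y

/-! ### Coordinates, trace, norm and absolute value on `K`. -/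

namespace IsImaginaryQuadratic

variable {F K : Type*} [Field F] [Field K] [Algebra F[X] K] [Algebra (RatFunc F) K]
  {α : F[X]} {s : K} {v : AbsoluteValue K ℝ}

local notation "ι" => algebraMap (RatFunc F) K
local notation "κ" => algebraMap (Polynomial F) (RatFunc F)

theorem two_ne_zero_base (h : IsImaginaryQuadratic α s v) : (2 : F) ≠ 0 := by
  have := h.two_lt_ringChar
  exact Ring.two_ne_zero (by omega)

theorem two_ne_zero_ratFunc (h : IsImaginaryQuadratic α s v) : (2 : RatFunc F) ≠ 0 := by
  have := (_root_.map_ne_zero (algebraMap F (RatFunc F))).mpr h.two_ne_zero_base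
  rwa [map_ofNat] at this

theorem two_ne_zero (h : IsImaginaryQuadratic α s v) : (2 : K) ≠ 0 := by
  have := (_root_.map_ne_zero (algebraMap (RatFunc F) K)).mpr h.two_ne_zero_ratFunc
  rwa [map_ofNat] at this

theorem ne_zero (h : IsImaginaryQuadratic α s v) : α ≠ 0 := h.squarefree.ne_zero

variable [IsScalarTower F[X] (RatFunc F) K]

theorem sq_eq' (h : IsImaginaryQuadratic α s v) : s ^ 2 = ι (κ α) := by
  rw [h.sq_eq, ← IsScalarTower.algebraMap_apply]

variable [Finite F]

theorem absInf_norm_form (h : IsImaginaryQuadratic α s v) (a b : RatFunc F) :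
    absInf (toKInf F (a ^ 2 - κ α * b ^ 2)) =
      max (absInf (toKInf F a) ^ 2) ((Nat.card F : ℝ) ^ α.natDegree * absInf (toKInf F b) ^ 2) := by
  rw [← absInf_polyToKInf h.ne_zero, ← absInf_sq_sub_mul_sq h.odd_or_not_isSquare, map_sub, map_mul,
    map_pow, map_pow, toKInf_algebraMap]

theorem absInf_toKInf_eq_zero {x : RatFunc F} : absInf (toKInf F x) = 0 ↔ x = 0 := by
  constructor
  · intro hx
    by_contra h0
    rw [absInf_of_ne_zero ((_root_.map_ne_zero _).mpr h0)] at hx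
    have := one_lt_card (F := F)
    exact (ne_of_gt (by positivity)) hx
  · rintro rfl
    rw [map_zero, absInf_zero]

/-- The form has size the maximum of its two terms, so it is anisotropic. This gives both the
independence of `1, √α` and the inverses in `exists_eq_add_mul`. -/
theorem norm_form_eq_zero (h : IsImaginaryQuadratic α s v) {a b : RatFunc F}
    (hab : a ^ 2 - κ α * b ^ 2 = 0) : a = 0 ∧ b = 0 := by
  have h1 := h.absInf_norm_form a b
  have hq := one_lt_card (F := F)
  have hq' : 0 < (Nat.card F : ℝ) ^ α.natDegree := by positivity
  rw [hab, map_zero, absInf_zero] at h1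
  have ha : absInf (toKInf F a) ^ 2 ≤ 0 := h1 ▸ le_max_left _ _
  have hb : (Nat.card F : ℝ) ^ α.natDegree * absInf (toKInf F b) ^ 2 ≤ 0 := h1 ▸ le_max_right _ _
  constructor
  · rw [← absInf_toKInf_eq_zero]
    exact pow_eq_zero_iff (n := 2) (by norm_num) |>.mp (le_antisymm ha (sq_nonneg _))
  · rw [← absInf_toKInf_eq_zero]
    have : absInf (toKInf F b) ^ 2 ≤ 0 := by
      by_contra! hc
      exact absurd hb (not_le.mpr (mul_pos hq' hc))
    exact pow_eq_zero_iff (n := 2) (by norm_num) |>.mp (le_antisymm this (sq_nonneg _))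

theorem add_mul_eq_zero (h : IsImaginaryQuadratic α s v) {a b : RatFunc F}
    (hab : ι a + ι b * s = 0) : a = 0 ∧ b = 0 := by
  apply h.norm_form_eq_zero
  apply (algebraMap (RatFunc F) K).injective
  rw [map_sub, map_mul, map_pow, map_pow, map_zero, ← h.sq_eq']
  linear_combination (ι a - ι b * s) * hab

theorem exists_eq_add_mul (h : IsImaginaryQuadratic α s v) (x : K) :
    ∃ a b : RatFunc F, x = ι a + ι b * s := by
  have hx : x ∈ IntermediateField.adjoin (RatFunc F) {s} := by
    rw [h.adjoin_eq_top]; exact IntermediateField.mem_top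
  induction hx using IntermediateField.adjoin_induction with
  | mem x hx =>
    rw [Set.mem_singleton_iff.mp hx]
    exact ⟨0, 1, by simp⟩
  | algebraMap x => exact ⟨x, 0, by simp⟩
  | add x y _ _ hx hy =>
    obtain ⟨a, b, rfl⟩ := hx
    obtain ⟨c, d, rfl⟩ := hy
    exact ⟨a + c, b + d, by rw [map_add, map_add]; ring⟩
  | inv x _ hx =>
    obtain ⟨a, b, rfl⟩ := hx
    by_cases h0 : a ^ 2 - κ α * b ^ 2 = 0
    · obtain ⟨rfl, rfl⟩ := h.norm_form_eq_zero h0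
      exact ⟨0, 0, by simp⟩
    · refine ⟨a / (a ^ 2 - κ α * b ^ 2), -b / (a ^ 2 - κ α * b ^ 2), ?_⟩
      have h1 : (ι a + ι b * s) * (ι a - ι b * s) = ι (a ^ 2 - κ α * b ^ 2) := by
        rw [map_sub, map_mul, map_pow, map_pow, ← h.sq_eq']; ring
      have h2 : ι (a ^ 2 - κ α * b ^ 2) ≠ 0 := (_root_.map_ne_zero _).mpr h0
      rw [map_div₀, map_div₀, map_neg]
      apply inv_eq_of_mul_eq_one_right
      field_simp
      linear_combination h1
  | mul x y _ _ hx hy =>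
    obtain ⟨a, b, rfl⟩ := hx
    obtain ⟨c, d, rfl⟩ := hy
    refine ⟨a * c + κ α * b * d, a * d + b * c, ?_⟩
    simp only [map_add, map_mul, ← h.sq_eq']
    ring

/-- The basis `1, √α` of `K` over `k`. -/
def basis (h : IsImaginaryQuadratic α s v) : Module.Basis (Fin 2) (RatFunc F) K :=
  Module.Basis.mk (v := ![1, s])
    (by
      rw [LinearIndependent.pair_iff]
      intro a b hab
      apply h.add_mul_eq_zero
      simpa [Algebra.smul_def] using hab)
    (by
      intro x _
      obtain ⟨a, b, rfl⟩ := h.exists_eq_add_mul x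
      rw [Matrix.range_cons, Matrix.range_cons, Matrix.range_empty, Set.union_empty,
        Set.singleton_union, Submodule.mem_span_pair]
      exact ⟨a, b, by simp [Algebra.smul_def]⟩)

theorem basis_zero (h : IsImaginaryQuadratic α s v) : h.basis 0 = 1 := by simp [basis]

theorem basis_one (h : IsImaginaryQuadratic α s v) : h.basis 1 = s := by simp [basis]

theorem basis_repr (h : IsImaginaryQuadratic α s v) (a b : RatFunc F) :
    ⇑(h.basis.repr (ι a + ι b * s)) = ![a, b] := by
  have : ι a + ι b * s = a • h.basis 0 + b • h.basis 1 := by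
    rw [h.basis_zero, h.basis_one, Algebra.smul_def, Algebra.smul_def, mul_one]
  rw [this, map_add, map_smul, map_smul, Module.Basis.repr_self, Module.Basis.repr_self]
  ext i
  fin_cases i <;> simp

theorem leftMulMatrix_basis (h : IsImaginaryQuadratic α s v) (a b : RatFunc F) :
    Algebra.leftMulMatrix h.basis (ι a + ι b * s) = !![a, κ α * b; b, a] := by
  have h1 : (ι a + ι b * s) * s = ι (κ α * b) + ι a * s := by
    rw [map_mul, ← h.sq_eq']; ring
  ext i j
  rw [Algebra.leftMulMatrix_eq_repr_mul]
  fin_cases j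
  · change h.basis.repr ((ι a + ι b * s) * h.basis 0) i = _
    rw [h.basis_zero, mul_one, h.basis_repr]
    fin_cases i <;> simp
  · change h.basis.repr ((ι a + ι b * s) * h.basis 1) i = _
    rw [h.basis_one, h1, h.basis_repr]
    fin_cases i <;> simp

theorem trace_add_mul (h : IsImaginaryQuadratic α s v) (a b : RatFunc F) :
    Algebra.trace (RatFunc F) K (ι a + ι b * s) = 2 * a := by
  rw [Algebra.trace_eq_matrix_trace h.basis, h.leftMulMatrix_basis, Matrix.trace_fin_two_of]
  ring

theorem norm_add_mul (h : IsImaginaryQuadratic α s v) (a b : RatFunc F) :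
    Algebra.norm (RatFunc F) (ι a + ι b * s) = a ^ 2 - κ α * b ^ 2 := by
  rw [Algebra.norm_eq_matrix_det h.basis, h.leftMulMatrix_basis, Matrix.det_fin_two_of]
  ring

/-- This explains the factor `1/(2√α)` in the exponential sum: it turns the trace into a coordinate
function. -/
theorem trace_div_two_mul (h : IsImaginaryQuadratic α s v) (a b : RatFunc F) :
    Algebra.trace (RatFunc F) K ((ι a + ι b * s) / (2 * s)) = b := by
  have hs : s ≠ 0 := by
    rintro hs
    have := h.sq_eq'
    rw [hs, zero_pow (by norm_num), eq_comm, map_eq_zero, map_eq_zero_iff _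
      (IsFractionRing.injective F[X] (RatFunc F))] at this
    exact h.ne_zero this
  have h2 := h.two_ne_zero
  have h2' := h.two_ne_zero_ratFunc
  have hα : κ α ≠ 0 := by
    rw [Ne, map_eq_zero_iff _ (IsFractionRing.injective F[X] (RatFunc F))]
    exact h.ne_zero
  have hα' : ι (κ α) ≠ 0 := (_root_.map_ne_zero _).mpr hα
  have : (ι a + ι b * s) / (2 * s) = ι (b / 2) + ι (a / (2 * κ α)) * s := by
    rw [map_div₀, map_div₀, map_mul, map_ofNat]
    field_simp
    rw [← h.sq_eq']
    ring
  rw [this, h.trace_add_mul]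
  field_simp

/-- Natural numbers are constants of `F`; this is what makes `v` ultrametric. -/
theorem abs_natCast_le_one (h : IsImaginaryQuadratic α s v) (n : ℕ) : v n ≤ 1 := by
  rw [← map_natCast ι n, h.abs_algebraMap, ← map_natCast κ, toKInf_algebraMap]
  by_cases hn : (n : F[X]) = 0
  · rw [hn, map_zero, absInf_zero]; exact zero_le_one
  · rw [absInf_polyToKInf hn, natDegree_natCast, pow_zero]

theorem abs_add_le_max (h : IsImaginaryQuadratic α s v) (x y : K) : v (x + y) ≤ max (v x) (v y) :=
  abs_add_le_max_of_natCast_le_one v h.abs_natCast_le_one x y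

theorem abs_sq_add_le (h : IsImaginaryQuadratic α s v) {x y : K} {B : ℝ}
    (hx : v x ^ 2 ≤ B) (hy : v y ^ 2 ≤ B) : v (x + y) ^ 2 ≤ B := by
  rcases le_max_iff.mp (h.abs_add_le_max x y) with h1 | h1
  · exact (pow_le_pow_left₀ (v.nonneg _) h1 2).trans hx
  · exact (pow_le_pow_left₀ (v.nonneg _) h1 2).trans hy

theorem abs_sq_sub_le (h : IsImaginaryQuadratic α s v) {x y : K} {B : ℝ}
    (hx : v x ^ 2 ≤ B) (hy : v y ^ 2 ≤ B) : v (x - y) ^ 2 ≤ B := by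
  rw [sub_eq_add_neg]
  exact h.abs_sq_add_le hx (by rwa [v.map_neg])

theorem abs_sq_sqrt (h : IsImaginaryQuadratic α s v) :
    v s ^ 2 = (Nat.card F : ℝ) ^ α.natDegree := by
  rw [← map_pow, h.sq_eq', h.abs_algebraMap, toKInf_algebraMap, absInf_polyToKInf h.ne_zero]

/-- The ultrametric inequality bounds the squared sizes of both `a + b√α` and its conjugate by the
maximum `M`. Their product is the norm, of size exactly `M`, so neither bound can be strict. -/
theorem abs_sq_add_mul (h : IsImaginaryQuadratic α s v) (a b : RatFunc F) :
    v (ι a + ι b * s) ^ 2 =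
      max (absInf (toKInf F a) ^ 2) ((Nat.card F : ℝ) ^ α.natDegree * absInf (toKInf F b) ^ 2) := by
  set M := max (absInf (toKInf F a) ^ 2)
    ((Nat.card F : ℝ) ^ α.natDegree * absInf (toKInf F b) ^ 2) with hM
  have h1 : v (ι a) ^ 2 ≤ M := by rw [h.abs_algebraMap]; exact le_max_left _ _
  have h2 : v (ι b * s) ^ 2 ≤ M := by
    rw [map_mul, mul_pow, h.abs_sq_sqrt, h.abs_algebraMap, mul_comm]; exact le_max_right _ _
  have h3 := h.abs_sq_add_le h1 h2
  have h4 := h.abs_sq_sub_le h1 h2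
  have h5 : v (ι a + ι b * s) * v (ι a - ι b * s) = M := by
    rw [hM, ← h.absInf_norm_form, ← h.abs_algebraMap, ← map_mul]
    congr 1
    rw [map_sub, map_mul, map_pow, map_pow, ← h.sq_eq']; ring
  have hM0 : 0 ≤ M := le_trans (sq_nonneg _) h1
  apply le_antisymm h3
  by_contra! hlt
  have h6 : M ^ 2 < M ^ 2 := by
    calc M ^ 2 = v (ι a + ι b * s) ^ 2 * v (ι a - ι b * s) ^ 2 := by rw [← h5]; ring
      _ ≤ v (ι a + ι b * s) ^ 2 * M := by gcongr
      _ < M * M := by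
        apply mul_lt_mul_of_pos_right hlt
        exact lt_of_le_of_lt (sq_nonneg _) hlt
      _ = M ^ 2 := (pow_two M).symm
  exact lt_irrefl _ h6

theorem abs_sq_eq_absInf_norm (h : IsImaginaryQuadratic α s v) (x : K) :
    v x ^ 2 = absInf (toKInf F (Algebra.norm (RatFunc F) x)) := by
  obtain ⟨a, b, rfl⟩ := h.exists_eq_add_mul x
  rw [h.abs_sq_add_mul, h.norm_add_mul, h.absInf_norm_form]

end IsImaginaryQuadratic


/-! ### The additive character and approximation by polynomials. -/

section Character

variable {F : Type*} [Field F] [Finite F]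

theorem charE_eq_stdAddChar [NeZero (ringChar F)] (x : F) :
    letI : Algebra (ZMod (ringChar F)) F := ZMod.algebra F (ringChar F)
    charE x = ZMod.stdAddChar (Algebra.trace (ZMod (ringChar F)) F x) := by
  rw [charE, ZMod.stdAddChar_apply, ZMod.toCircle_apply]
  congr 1
  ring

theorem neZero_ringChar (F : Type*) [Field F] [Finite F] : NeZero (ringChar F) :=
  ⟨(CharP.char_is_prime F _).ne_zero⟩

theorem charE_add (x y : F) : charE (x + y) = charE x * charE y := by
  have := neZero_ringChar F
  rw [charE_eq_stdAddChar, charE_eq_stdAddChar, charE_eq_stdAddChar, map_add,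
    AddChar.map_add_eq_mul]

theorem charE_zero : charE (0 : F) = 1 := by
  have := neZero_ringChar F
  rw [charE_eq_stdAddChar, map_zero, AddChar.map_zero_eq_one]

theorem eq_zero_of_charE_mul_eq_one {x : F} (hx : ∀ c : F, charE (c * x) = 1) : x = 0 := by
  have := neZero_ringChar F
  let _ : Algebra (ZMod (ringChar F)) F := ZMod.algebra F (ringChar F)
  by_contra h0
  obtain ⟨b, hb⟩ := FiniteField.trace_to_zmod_nondegenerate F h0
  apply hb
  have h1 := hx b
  rw [mul_comm, charE_eq_stdAddChar, ← (ZMod.stdAddChar (N := ringChar F)).map_zero_eq_one] at h1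
  exact ZMod.injective_stdAddChar h1

theorem charInf_add (x y : LaurentSeries F) : charInf (x + y) = charInf x * charInf y := by
  rw [charInf, HahnSeries.coeff_add, charE_add]; rfl

theorem charInf_zero : charInf (0 : LaurentSeries F) = 1 := by
  rw [charInf, HahnSeries.coeff_zero, charE_zero]

/-- A series orthogonal to all polynomials `p` with `2 deg p + D ≤ N` is close to a polynomial. -/
theorem exists_absInf_sub_sq_le (x : LaurentSeries F) (N D : ℕ)
    (hx : ∀ n : ℕ, 2 * n + D ≤ N → ∀ c : F, charInf (polyToKInf F (monomial n c) * x) = 1) :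
    ∃ p : F[X], absInf (x - polyToKInf F p) ^ 2 ≤ (Nat.card F : ℝ) ^ ((D : ℤ) - N) := by
  have hq := one_lt_card (F := F)
  obtain ⟨p, hp⟩ := exists_coeff_sub_polyToKInf_eq_zero x
  refine ⟨p, ?_⟩
  by_cases h0 : x - polyToKInf F p = 0
  · rw [h0, absInf_zero, zero_pow (by norm_num)]
    positivity
  rw [absInf_of_ne_zero h0, ← zpow_natCast, ← zpow_mul]
  apply zpow_le_zpow_right₀ hq.le
  by_contra! hlt
  set o := (x - polyToKInf F p).order with ho
  have hne : (x - polyToKInf F p).coeff o ≠ 0 := HahnSeries.coeff_order_eq_zero.not.mpr h0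
  have hpos : 0 < o := by
    by_contra! h1
    exact hne (hp o h1)
  apply hne
  rw [HahnSeries.coeff_sub, polyToKInf_coeff_pos p hpos, sub_zero]
  apply eq_zero_of_charE_mul_eq_one
  intro c
  push_cast at hlt
  -- Multiplication by `c t^(o-1)` moves the coefficient of index `o` to index `1`, the one seen by
  -- `charInf`.
  have h1 := hx (o - 1).toNat (by omega) c
  have h2 : polyToKInf F (monomial (o - 1).toNat c) = HahnSeries.single (-((o - 1).toNat : ℤ)) c := by
    simp [polyToKInf, HahnSeries.C_apply, HahnSeries.single_pow, HahnSeries.single_mul_single]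
  rw [charInf, h2, HahnSeries.coeff_single_mul] at h1
  rwa [show (1 : ℤ) - -((o - 1).toNat : ℤ) = o by omega] at h1

end Character

/-! ### The ring of integers as a lattice: balls, duality, quotients. -/

namespace IsImaginaryQuadratic

variable {F K : Type*} [Field F] [Field K] [Algebra F[X] K] [Algebra (RatFunc F) K]
  {α : F[X]} {s : K} {v : AbsoluteValue K ℝ}
  [IsScalarTower F[X] (RatFunc F) K] [Finite F]

local notation "ι" => algebraMap (RatFunc F) K
local notation "κ" => algebraMap (Polynomial F) (RatFunc F)
local notation "𝔸" => integralClosure (Polynomial F) K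

theorem isIntegral_sqrt (h : IsImaginaryQuadratic α s v) : IsIntegral F[X] s := by
  apply IsIntegral.of_pow (n := 2) (by norm_num)
  rw [h.sq_eq]
  exact isIntegral_algebraMap

/-- The integer `a + b √α` of `K`. -/
def toInt (h : IsImaginaryQuadratic α s v) (a b : F[X]) : 𝔸 :=
  algebraMap F[X] 𝔸 a + algebraMap F[X] 𝔸 b * ⟨s, h.isIntegral_sqrt⟩

theorem coe_toInt (h : IsImaginaryQuadratic α s v) (a b : F[X]) :
    ((h.toInt a b : 𝔸) : K) = ι (κ a) + ι (κ b) * s := by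
  rw [← IsScalarTower.algebraMap_apply, ← IsScalarTower.algebraMap_apply]
  rfl

theorem finiteDimensional (h : IsImaginaryQuadratic α s v) : FiniteDimensional (RatFunc F) K :=
  Module.Finite.of_basis h.basis

/-- The square of the denominator of `b` divides `α`, which is squarefree. -/
theorem exists_eq_of_mul_sq_eq {α : F[X]} (hα : Squarefree α) {b : RatFunc F} {w : F[X]}
    (hb : κ α * b ^ 2 = κ w) : ∃ p : F[X], κ p = b := by
  have hinj := IsFractionRing.injective F[X] (RatFunc F)
  have hd : b.denom ≠ 0 := b.denom_ne_zero
  have hd' : κ b.denom ≠ 0 := by rwa [Ne, map_eq_zero_iff _ hinj]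
  have h1 : α * b.num ^ 2 = w * b.denom ^ 2 := by
    apply hinj
    rw [map_mul, map_mul, map_pow, map_pow, ← hb]
    nth_rw 2 [← RatFunc.num_div_denom b]
    field_simp
  have h2 : b.denom * b.denom ∣ α := by
    rw [← pow_two]
    apply (b.isCoprime_num_denom.symm.pow (m := 2) (n := 2)).dvd_of_dvd_mul_right
    exact ⟨w, by rw [h1, mul_comm]⟩
  have h3 : b.denom = 1 := (b.monic_denom).eq_one_of_isUnit (hα _ h2)
  refine ⟨b.num, ?_⟩
  nth_rw 2 [← RatFunc.num_div_denom b]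
  rw [h3, map_one, div_one]

/-- The trace `2a` is a polynomial, hence so is `a` since `2` is invertible; the norm then makes `α
b²` a polynomial. -/
theorem exists_toInt_eq (h : IsImaginaryQuadratic α s v) (x : 𝔸) : ∃ a b : F[X], x = h.toInt a b := by
  have hfd := h.finiteDimensional
  have h2 := h.two_ne_zero_base
  obtain ⟨a, b, hab⟩ := h.exists_eq_add_mul (x : K)
  have ht : IsIntegral F[X] (Algebra.trace (RatFunc F) K (x : K)) := Algebra.isIntegral_trace x.2
  have hn : IsIntegral F[X] (Algebra.norm (RatFunc F) (x : K)) := Algebra.isIntegral_norm _ x.2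
  rw [IsIntegrallyClosed.isIntegral_iff] at ht hn
  obtain ⟨t, ht⟩ := ht
  obtain ⟨n, hn⟩ := hn
  rw [hab, h.trace_add_mul] at ht
  rw [hab, h.norm_add_mul] at hn
  have ha : κ (C (2⁻¹ : F) * t) = a := by
    have h4 : κ (C (2⁻¹ : F)) * 2 = 1 := by
      rw [← map_ofNat κ 2, ← map_mul, ← map_ofNat C 2, ← C_mul, inv_mul_cancel₀ h2, C_1, map_one]
    rw [map_mul, ht, ← mul_assoc, h4, one_mul]
  obtain ⟨b', hb'⟩ := exists_eq_of_mul_sq_eq (w := (C (2⁻¹ : F) * t) ^ 2 - n) h.squarefree (b := b) (by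
    rw [map_sub, map_pow, ha, hn]; ring)
  exact ⟨C (2⁻¹ : F) * t, b', Subtype.ext (by rw [coe_toInt, ha, hb', hab])⟩

theorem abs_sq_toInt (h : IsImaginaryQuadratic α s v) (a b : F[X]) :
    v (h.toInt a b : K) ^ 2 = max (absInf (polyToKInf F a) ^ 2)
      ((Nat.card F : ℝ) ^ α.natDegree * absInf (polyToKInf F b) ^ 2) := by
  rw [coe_toInt, h.abs_sq_add_mul, toKInf_algebraMap, toKInf_algebraMap]

theorem mem_degreeLT_of_absInf_sq_le {p : F[X]} {M : ℕ}
    (hp : absInf (polyToKInf F p) ^ 2 ≤ (Nat.card F : ℝ) ^ M) : p ∈ degreeLT F (M / 2 + 1) := by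
  by_cases h0 : p = 0
  · rw [h0]; exact zero_mem _
  rw [absInf_polyToKInf h0, ← pow_mul, pow_le_pow_iff_right₀ one_lt_card] at hp
  rw [mem_degreeLT, ← natDegree_lt_iff_degree_lt h0]
  omega

theorem ballInt_subset_image (h : IsImaginaryQuadratic α s v) (M : ℕ) :
    ballInt (F := F) v M ⊆ (fun x : F[X] × F[X] => h.toInt x.1 x.2) ''
      ((degreeLT F (M / 2 + 1) : Set F[X]) ×ˢ (degreeLT F (M / 2 + 1) : Set F[X])) := by
  have hq := one_lt_card (F := F)
  intro g hg
  obtain ⟨a, b, rfl⟩ := h.exists_toInt_eq g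
  rw [ballInt, Set.mem_ofPred_eq, abs_sq_toInt, max_le_iff] at hg
  refine ⟨(a, b), ⟨mem_degreeLT_of_absInf_sq_le hg.1, mem_degreeLT_of_absInf_sq_le ?_⟩, rfl⟩
  exact (le_mul_of_one_le_left (sq_nonneg _) (one_le_pow₀ hq.le)).trans hg.2

theorem finite_degreeLT (n : ℕ) : (degreeLT F n : Set F[X]).Finite :=
  (Set.finite_coe_iff (s := (degreeLT F n : Set F[X]))).mp
    (Finite.of_equiv _ (degreeLTEquiv F n).toEquiv.symm)

theorem ncard_degreeLT (n : ℕ) : (degreeLT F n : Set F[X]).ncard = Nat.card F ^ n := by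
  rw [← Nat.card_coe_set_eq]
  refine (Nat.card_congr (degreeLTEquiv F n).toEquiv).trans ?_
  rw [Nat.card_fun, Nat.card_fin]

theorem finite_ballInt (h : IsImaginaryQuadratic α s v) (M : ℕ) : (ballInt (F := F) v M).Finite :=
  ((finite_degreeLT _).prod (finite_degreeLT _)).image _ |>.subset (h.ballInt_subset_image M)

/-- Both coordinates have degree at most `M / 2`. The gain from `v(√α)` is ignored, which costs only
a constant. -/
theorem ncard_ballInt_le (h : IsImaginaryQuadratic α s v) (M : ℕ) :
    (ballInt (F := F) v M).ncard ≤ Nat.card F ^ (M + 2) := by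
  have hf := (finite_degreeLT (F := F) (M / 2 + 1)).prod (finite_degreeLT (F := F) (M / 2 + 1))
  calc (ballInt (F := F) v M).ncard ≤ _ :=
        Set.ncard_le_ncard (h.ballInt_subset_image M) (hf.image _)
    _ ≤ _ := Set.ncard_image_le hf
    _ = Nat.card F ^ (M / 2 + 1 + (M / 2 + 1)) := by
      rw [Set.ncard_prod, ncard_degreeLT, ← pow_add]
    _ ≤ _ := Nat.pow_le_pow_right Nat.card_pos (by omega)

theorem moduli_subset_ballInt (Q : ℕ) : moduli (F := F) v Q ⊆ ballInt v Q := fun _ hf => hf.2.le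

theorem finite_moduli (h : IsImaginaryQuadratic α s v) (Q : ℕ) : (moduli (F := F) v Q).Finite :=
  (h.finite_ballInt Q).subset (moduli_subset_ballInt Q)

theorem one_le_abs_sq (h : IsImaginaryQuadratic α s v) {x : 𝔸} (hx : x ≠ 0) : 1 ≤ v (x : K) ^ 2 := by
  have hq := one_lt_card (F := F)
  obtain ⟨a, b, rfl⟩ := h.exists_toInt_eq x
  rw [abs_sq_toInt]
  by_cases ha : a = 0
  · have hb : b ≠ 0 := by
      rintro rfl
      apply hx
      simp [ha, toInt]
    apply le_max_of_le_right
    rw [absInf_polyToKInf hb, ← pow_mul, ← pow_add]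
    exact one_le_pow₀ hq.le
  · apply le_max_of_le_left
    rw [absInf_polyToKInf ha, ← pow_mul]
    exact one_le_pow₀ hq.le

/-- If `z` is orthogonal to `𝐁(0, N) ∩ 𝔸`, then it is close to an integer. -/
theorem exists_abs_sub_sq_le (h : IsImaginaryQuadratic α s v) (z : K) (N : ℕ)
    (hz : ∀ g ∈ ballInt (F := F) v N,
      charInf (toKInf F (Algebra.trace (RatFunc F) K ((g : K) * z / (2 * s)))) = 1) :
    ∃ w : 𝔸, v (z - w) ^ 2 ≤ (Nat.card F : ℝ) ^ ((α.natDegree : ℤ) - N) := by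
  have hq := one_lt_card (F := F)
  have hmon (n : ℕ) (c : F) (M : ℕ) (hn : 2 * n ≤ M) :
      absInf (polyToKInf F (monomial n c)) ^ 2 ≤ (Nat.card F : ℝ) ^ M := by
    by_cases hc : monomial n c = 0
    · rw [hc, map_zero, absInf_zero, zero_pow (by norm_num)]; positivity
    · rw [absInf_polyToKInf hc, ← pow_mul]
      apply pow_le_pow_right₀ hq.le
      have := natDegree_monomial_le (m := n) c
      omega
  obtain ⟨a, b, rfl⟩ := h.exists_eq_add_mul z
  -- Testing against `g = c t^n √α` isolates the coordinate `a`; as `𝐍(√α) = q^d`, such `g` lies in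
  -- the ball when `2n + d ≤ N`.
  obtain ⟨p, hp⟩ := exists_absInf_sub_sq_le (toKInf F a) N α.natDegree (fun n hn c => by
    have h1 := hz (h.toInt 0 (monomial n c)) (by
      rw [ballInt, Set.mem_ofPred_eq, abs_sq_toInt, map_zero, absInf_zero]
      apply max_le
      · rw [zero_pow (by norm_num)]; positivity
      · calc _ ≤ (Nat.card F : ℝ) ^ α.natDegree * (Nat.card F : ℝ) ^ (N - α.natDegree) := by
              gcongr
              exact hmon n c _ (by omega)
          _ = _ := by rw [← pow_add]; congr 1; omega)
    rw [coe_toInt, map_zero, map_zero, zero_add] at h1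
    rw [show ι (κ (monomial n c)) * s * (ι a + ι b * s) =
      ι (κ (monomial n c) * (κ α * b)) + ι (κ (monomial n c) * a) * s by
        simp only [map_mul, ← h.sq_eq']; ring, h.trace_div_two_mul, map_mul,
        toKInf_algebraMap] at h1
    exact h1)
  -- Testing against `g = c t^n` isolates `b`, with no loss of degree; the factor `q^d` returns with
  -- `√α` in the final bound.
  obtain ⟨r, hr⟩ := exists_absInf_sub_sq_le (toKInf F b) N 0 (fun n hn c => by
    have h1 := hz (h.toInt (monomial n c) 0) (by
      rw [ballInt, Set.mem_ofPred_eq, abs_sq_toInt, map_zero, absInf_zero]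
      apply max_le
      · exact hmon n c _ (by omega)
      · rw [zero_pow (by norm_num), mul_zero]; positivity)
    rw [coe_toInt, map_zero, map_zero, zero_mul, add_zero] at h1
    rw [show ι (κ (monomial n c)) * (ι a + ι b * s) =
      ι (κ (monomial n c) * a) + ι (κ (monomial n c) * b) * s by
        simp only [map_mul]; ring, h.trace_div_two_mul, map_mul,
        toKInf_algebraMap] at h1
    exact h1)
  refine ⟨h.toInt p r, ?_⟩
  have : ι a + ι b * s - (h.toInt p r : K) = ι (a - κ p) + ι (b - κ r) * s := by
    rw [coe_toInt, map_sub, map_sub]; ring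
  rw [this, h.abs_sq_add_mul, map_sub, map_sub, toKInf_algebraMap, toKInf_algebraMap]
  apply max_le hp
  calc _ ≤ (Nat.card F : ℝ) ^ α.natDegree * (Nat.card F : ℝ) ^ (((0 : ℕ) : ℤ) - N) := by gcongr
    _ = _ := by rw [← zpow_natCast, ← zpow_add₀ (by positivity)]; congr 1; push_cast; ring

/-- Every element of `K` is at bounded distance from an integer. -/
theorem exists_abs_sub_sq_le_pow (h : IsImaginaryQuadratic α s v) (z : K) :
    ∃ w : 𝔸, v (z - w) ^ 2 ≤ (Nat.card F : ℝ) ^ (α.natDegree + 1) := by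
  have hq := one_lt_card (F := F)
  obtain ⟨a, b, rfl⟩ := h.exists_eq_add_mul z
  -- With `N = 0` and `D = 1` there is nothing to test, so this merely takes the integer part.
  obtain ⟨p, hp⟩ := exists_absInf_sub_sq_le (toKInf F a) 0 1 (fun n hn => by omega)
  obtain ⟨r, hr⟩ := exists_absInf_sub_sq_le (toKInf F b) 0 1 (fun n hn => by omega)
  refine ⟨h.toInt p r, ?_⟩
  have : ι a + ι b * s - (h.toInt p r : K) = ι (a - κ p) + ι (b - κ r) * s := by
    rw [coe_toInt, map_sub, map_sub]; ring
  rw [this, h.abs_sq_add_mul, map_sub, map_sub, toKInf_algebraMap, toKInf_algebraMap]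
  norm_num at hp hr
  apply max_le
  · exact hp.trans (le_self_pow₀ hq.le (by omega))
  · rw [pow_succ]
    exact mul_le_mul_of_nonneg_left hr (by positivity)

/-- Rounding `r / f` to a nearby integer reduces every class to a representative of bounded size. -/
theorem finite_quotient (h : IsImaginaryQuadratic α s v) {f : 𝔸} (hf : f ≠ 0) :
    Finite (𝔸 ⧸ Ideal.span {f}) := by
  have hq := one_lt_card (F := F)
  have hf' : (f : K) ≠ 0 := by simpa using hf
  obtain ⟨M, hM⟩ := pow_unbounded_of_one_lt
    ((Nat.card F : ℝ) ^ (α.natDegree + 1) * v (f : K) ^ 2) hq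
  apply Set.finite_univ_iff.mp
  refine ((h.finite_ballInt M).image (Ideal.Quotient.mk (Ideal.span {f}))).subset fun c _ => ?_
  obtain ⟨r, rfl⟩ := Ideal.Quotient.mk_surjective c
  obtain ⟨w, hw⟩ := h.exists_abs_sub_sq_le_pow ((r : K) / f)
  refine ⟨r - w * f, ?_, ?_⟩
  · have : ((r - w * f : 𝔸) : K) = ((r : K) / f - w) * f := by
      push_cast; field_simp
    rw [ballInt, Set.mem_ofPred_eq, this, map_mul, mul_pow]
    exact (mul_le_mul_of_nonneg_right hw (sq_nonneg _)).trans hM.le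
  · rw [Ideal.Quotient.eq, Ideal.mem_span_singleton]
    exact ⟨-w, by ring⟩

end IsImaginaryQuadratic


/-! ### Parseval and the abstract large sieve. -/

section FiniteGroup

variable {G : Type*} [AddCommGroup G]

/-- Parseval's identity on a finite abelian group. -/
theorem sum_norm_sq_charSum [Fintype G] (a : G → ℂ) :
    ∑ ψ : AddChar G ℂ, ‖∑ g, a g * ψ g‖ ^ 2 = Fintype.card G * ∑ g, ‖a g‖ ^ 2 := by
  classical
  have h1 (ψ : AddChar G ℂ) : ((‖∑ g, a g * ψ g‖ ^ 2 : ℝ) : ℂ) =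
      ∑ g, ∑ k, a g * (starRingEnd ℂ) (a k) * ψ (g - k) := by
    rw [Complex.ofReal_pow, ← Complex.mul_conj', map_sum, Finset.sum_mul_sum]
    refine Finset.sum_congr rfl fun g _ => Finset.sum_congr rfl fun k _ => ?_
    rw [map_mul, sub_eq_add_neg, AddChar.map_add_eq_mul, AddChar.map_neg_eq_conj]
    ring
  apply Complex.ofReal_injective
  rw [Complex.ofReal_sum, Finset.sum_congr rfl fun ψ _ => h1 ψ, Finset.sum_comm]
  rw [Complex.ofReal_mul, Complex.ofReal_natCast, Complex.ofReal_sum, Finset.mul_sum]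
  refine Finset.sum_congr rfl fun g _ => ?_
  rw [Finset.sum_comm]
  simp_rw [← Finset.mul_sum, AddChar.sum_apply_eq_ite]
  simp only [sub_eq_zero, mul_ite, mul_zero, Finset.sum_ite_eq, Finset.mem_univ, if_true]
  rw [Complex.ofReal_pow, ← Complex.mul_conj', mul_comm]

/-- The large sieve inequality for a family of characters of a finite abelian group in which no
character occurs more than `B` times. -/
theorem sum_norm_sq_le_of_card_fiber_le [Fintype G] {I : Type*} (S : Finset I)
    (ψ : I → AddChar G ℂ) (B : ℝ) (hB0 : 0 ≤ B)
    (hB : ∀ i ∈ S, ({j : I | j ∈ S ∧ ψ j = ψ i}.ncard : ℝ) ≤ B) (a : G → ℂ) :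
    ∑ i ∈ S, ‖∑ g, a g * ψ i g‖ ^ 2 ≤ B * (Fintype.card G * ∑ g, ‖a g‖ ^ 2) := by
  classical
  rw [← sum_norm_sq_charSum, Finset.mul_sum,
    ← Finset.sum_fiberwise S ψ (fun i => ‖∑ g, a g * ψ i g‖ ^ 2)]
  refine Finset.sum_le_sum fun χ _ => ?_
  have h1 : ∑ i ∈ S with ψ i = χ, ‖∑ g, a g * ψ i g‖ ^ 2 =
      ∑ i ∈ S with ψ i = χ, ‖∑ g, a g * χ g‖ ^ 2 :=
    Finset.sum_congr rfl fun i hi => by rw [(Finset.mem_filter.mp hi).2]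
  rw [h1, Finset.sum_const, nsmul_eq_mul]
  apply mul_le_mul_of_nonneg_right _ (sq_nonneg _)
  rcases (S.filter (fun i => ψ i = χ)).eq_empty_or_nonempty with h0 | ⟨i, hi⟩
  · rw [h0, Finset.card_empty, Nat.cast_zero]; exact hB0
  · rw [Finset.mem_filter] at hi
    have := hB i hi.1
    rw [← Set.ncard_coe_finset, Finset.coe_filter]
    rwa [hi.2] at this

end FiniteGroup

/-! ### Characters of the ball attached to elements of `K`. -/

namespace IsImaginaryQuadratic

variable {F K : Type*} [Field F] [Field K] [Algebra F[X] K] [Algebra (RatFunc F) K]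
  {α : F[X]} {s : K} {v : AbsoluteValue K ℝ}
  [IsScalarTower F[X] (RatFunc F) K] [Finite F]

local notation "𝔸" => integralClosure (Polynomial F) K

/-- The ball `𝐁(0, N) ∩ 𝔸` as a group. -/
def ballGroup (h : IsImaginaryQuadratic α s v) (N : ℕ) : AddSubgroup 𝔸 where
  carrier := ballInt v N
  add_mem' {x y} hx hy := h.abs_sq_add_le hx hy
  zero_mem' := by
    change v (0 : K) ^ 2 ≤ _
    rw [map_zero, zero_pow (by norm_num)]
    positivity
  neg_mem' {x} hx := by
    change v (-(x : K)) ^ 2 ≤ _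
    rw [v.map_neg]
    exact hx

/-- The character `g ↦ e(Tr(g x / (2 √α)))` of `𝐁(0, N) ∩ 𝔸`. -/
def pairingChar (h : IsImaginaryQuadratic α s v) (N : ℕ) (x : K) : AddChar (h.ballGroup N) ℂ where
  toFun g := charInf (toKInf F (Algebra.trace (RatFunc F) K (((g : 𝔸) : K) * x / (2 * s))))
  map_zero_eq_one' := by
    simp [charInf_zero]
  map_add_eq_mul' g k := by
    rw [← charInf_add, ← map_add, ← map_add]
    congr 3
    push_cast
    ring

theorem exists_abs_sub_sq_le_of_pairingChar_eq (h : IsImaginaryQuadratic α s v) {N : ℕ} {x y : K}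
    (hxy : h.pairingChar N x = h.pairingChar N y) :
    ∃ w : 𝔸, v (x - y - w) ^ 2 ≤ (Nat.card F : ℝ) ^ ((α.natDegree : ℤ) - N) := by
  apply h.exists_abs_sub_sq_le
  intro g hg
  have h1 : h.pairingChar N x ⟨g, hg⟩ = h.pairingChar N y ⟨g, hg⟩ := by rw [hxy]
  change charInf (toKInf F (Algebra.trace (RatFunc F) K ((g : K) * x / (2 * s)))) =
    charInf (toKInf F (Algebra.trace (RatFunc F) K ((g : K) * y / (2 * s)))) at h1
  have h2 : charInf (toKInf F (Algebra.trace (RatFunc F) K ((g : K) * (x - y) / (2 * s)))) *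
      charInf (toKInf F (Algebra.trace (RatFunc F) K ((g : K) * y / (2 * s)))) =
      charInf (toKInf F (Algebra.trace (RatFunc F) K ((g : K) * x / (2 * s)))) := by
    rw [← charInf_add, ← map_add, ← map_add]
    congr 3
    ring
  have h3 : charInf (toKInf F (Algebra.trace (RatFunc F) K ((g : K) * y / (2 * s)))) ≠ 0 := by
    intro h0
    have h4 := charInf_add (toKInf F (Algebra.trace (RatFunc F) K ((g : K) * y / (2 * s))))
      (-toKInf F (Algebra.trace (RatFunc F) K ((g : K) * y / (2 * s))))
    rw [add_neg_cancel, charInf_zero, h0, zero_mul] at h4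
    exact one_ne_zero h4
  apply mul_right_cancel₀ h3
  rw [h2, h1, one_mul]

theorem expSum_eq (h : IsImaginaryQuadratic α s v) (N : ℕ) [Fintype (h.ballGroup N)]
    (a : 𝔸 → ℂ) (f r : 𝔸) :
    expSum v s N a f r = ∑ g : h.ballGroup N, a g * h.pairingChar N ((r : K) / (f : K) ^ 2) g := by
  rw [expSum, ← finsum_eq_sum_of_fintype]
  rw [← finsum_set_coe_eq_finsum_mem (ballInt (F := F) v N)]
  refine finsum_congr fun g => ?_
  congr 1
  change _ = charInf (toKInf F (Algebra.trace (RatFunc F) K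
    ((g : K) * ((r : K) / (f : K) ^ 2) / (2 * s))))
  congr 3
  field_simp

/-- The large sieve bounded by the multiplicity with which characters occur. -/
theorem sieveSum_le (h : IsImaginaryQuadratic α s v) (Q N : ℕ) (a : 𝔸 → ℂ) (B : ℝ) (hB0 : 0 ≤ B)
    (hB : ∀ f₀ ∈ moduli (F := F) v Q, ∀ r₀ : 𝔸, IsCoprime r₀ f₀ →
      ∃ (S : Finset 𝔸) (B₁ : ℕ), (S.card : ℝ) * B₁ ≤ B ∧
        ∀ f ∈ moduli (F := F) v Q,
          {c : 𝔸 ⧸ Ideal.span {f ^ 2} | h.pairingChar N ((c.out : K) / (f : K) ^ 2) =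
            h.pairingChar N ((r₀ : K) / (f₀ : K) ^ 2)}.ncard ≤ B₁ ∧
          ((∃ c : 𝔸 ⧸ Ideal.span {f ^ 2}, h.pairingChar N ((c.out : K) / (f : K) ^ 2) =
            h.pairingChar N ((r₀ : K) / (f₀ : K) ^ 2)) → f ∈ S)) :
    sieveSum v s Q N a ≤ B * ((ballInt (F := F) v N).ncard *
      ∑ᶠ g ∈ ballInt (F := F) v N, ‖a g‖ ^ 2) := by
  classical
  have hfin := h.finite_ballInt N
  have : Fintype (h.ballGroup N) := hfin.fintype
  have hmod := h.finite_moduli Q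
  have hquot (f : 𝔸) (hf : f ∈ moduli (F := F) v Q) : Finite (𝔸 ⧸ Ideal.span {f ^ 2}) :=
    h.finite_quotient (pow_ne_zero 2 hf.1)
  -- A sigma type needs a value at every `f`; finiteness is available for moduli only, and the
  -- default `∅` is never met there.
  let T (f : 𝔸) : Finset (𝔸 ⧸ Ideal.span {f ^ 2}) :=
    if hf : {c : 𝔸 ⧸ Ideal.span {f ^ 2} | IsCoprime c.out f}.Finite then hf.toFinset else ∅
  have hT (f : 𝔸) (hf : f ∈ moduli (F := F) v Q) (c : 𝔸 ⧸ Ideal.span {f ^ 2}) :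
      c ∈ T f ↔ IsCoprime c.out f := by
    have := hquot f hf
    have hfin' := Set.toFinite {c : 𝔸 ⧸ Ideal.span {f ^ 2} | IsCoprime c.out f}
    simp only [T, dif_pos hfin', Set.Finite.mem_toFinset, Set.mem_ofPred_eq]
  have h1 : sieveSum v s Q N a = ∑ i ∈ hmod.toFinset.sigma T,
      ‖∑ g : h.ballGroup N, a g *
        h.pairingChar N ((i.2.out : K) / (i.1 : K) ^ 2) g‖ ^ 2 := by
    rw [Finset.sum_sigma, sieveSum, finsum_mem_eq_finite_toFinset_sum _ hmod]
    refine Finset.sum_congr rfl fun f hf => ?_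
    rw [Set.Finite.mem_toFinset] at hf
    have := hquot f hf
    rw [finsum_mem_eq_finite_toFinset_sum _ (Set.toFinite _)]
    refine Finset.sum_congr ?_ fun c _ => by rw [h.expSum_eq]
    ext c
    rw [hT f hf, Set.Finite.mem_toFinset, Set.mem_ofPred_eq]
  have h2 : ∑ᶠ g ∈ ballInt (F := F) v N, ‖a g‖ ^ 2 = ∑ g : h.ballGroup N, ‖a g‖ ^ 2 := by
    rw [← finsum_eq_sum_of_fintype, ← finsum_set_coe_eq_finsum_mem (ballInt (F := F) v N)]
    rfl
  have h3 : (ballInt (F := F) v N).ncard = Fintype.card (h.ballGroup N) := by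
    rw [← Nat.card_coe_set_eq, ← Nat.card_eq_fintype_card]
    rfl
  rw [h1, h2, h3]
  refine sum_norm_sq_le_of_card_fiber_le _
    (fun i : (f : 𝔸) × (𝔸 ⧸ Ideal.span {f ^ 2}) =>
      h.pairingChar N ((i.2.out : K) / (i.1 : K) ^ 2)) B hB0 ?_ (fun g => a g)
  rintro ⟨f₀, c₀⟩ hi
  rw [Finset.mem_sigma, Set.Finite.mem_toFinset] at hi
  obtain ⟨S, B₁, hS, hSB⟩ := hB f₀ hi.1 c₀.out ((hT f₀ hi.1 c₀).mp hi.2)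
  refine le_trans ?_ hS
  rw [← Nat.cast_mul, Nat.cast_le]
  let T' (f : 𝔸) : Finset (𝔸 ⧸ Ideal.span {f ^ 2}) :=
    (T f).filter fun c => h.pairingChar N ((c.out : K) / (f : K) ^ 2) =
      h.pairingChar N ((c₀.out : K) / (f₀ : K) ^ 2)
  have h4 : {j : (f : 𝔸) × (𝔸 ⧸ Ideal.span {f ^ 2}) | j ∈ hmod.toFinset.sigma T ∧
      h.pairingChar N ((j.2.out : K) / (j.1 : K) ^ 2) =
      h.pairingChar N ((c₀.out : K) / (f₀ : K) ^ 2)} ⊆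
      ((S.filter (· ∈ moduli (F := F) v Q)).sigma T' : Finset _) := by
    rintro ⟨f, c⟩ ⟨hj, hj'⟩
    rw [Finset.mem_sigma, Set.Finite.mem_toFinset] at hj
    rw [Finset.mem_coe, Finset.mem_sigma, Finset.mem_filter, Finset.mem_filter]
    exact ⟨⟨(hSB f hj.1).2 ⟨c, hj'⟩, hj.1⟩, hj.2, hj'⟩
  refine (Set.ncard_le_ncard h4 (Finset.finite_toSet _)).trans ?_
  rw [Set.ncard_coe_finset, Finset.card_sigma]
  refine (Finset.sum_le_card_nsmul _ _ B₁ fun f hf => ?_).trans ?_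
  · rw [Finset.mem_filter] at hf
    have := hquot f hf.2
    refine le_trans ?_ (hSB f hf.2).1
    rw [← Set.ncard_coe_finset]
    refine Set.ncard_le_ncard (fun c hc => ?_) (Set.toFinite _)
    exact (Finset.mem_filter.mp (Finset.mem_coe.mp hc)).2
  · rw [smul_eq_mul]
    exact Nat.mul_le_mul_right _ (Finset.card_filter_le _ _)

end IsImaginaryQuadratic


/-! ### A divisor bound for weighted multisets. -/

section Divisors

/-- For weight one, `2^e` alone does not dominate `(e+1)²` when `e` is small; a factor `4` per such
element repairs this. -/
theorem succ_sq_le_four_mul_two_pow (e : ℕ) : (e + 1) ^ 2 ≤ 4 * 2 ^ e := by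
  rcases Nat.lt_or_ge e 3 with he | he
  · interval_cases e <;> norm_num
  · induction e, he using Nat.le_induction with
    | base => norm_num
    | succ n hn ih => rw [pow_succ 2]; nlinarith

/-- A divisor bound for multisets: the number of submultisets is at most `√2` to the weight, up to a
constant that depends only on the number of elements of weight one. -/
theorem card_Iic_sq_le {β : Type*} [DecidableEq β] (S : Multiset β) (w : β → ℕ)
    (hw : ∀ b ∈ S, 0 < w b) (k : ℕ) (hk : (S.toFinset.filter fun b => w b = 1).card ≤ k) :
    (Finset.Iic S).card ^ 2 ≤ 4 ^ k * 2 ^ (S.map w).sum := by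
  have h1 : (S.map w).sum = ∑ b ∈ S.toFinset, S.count b * w b := by
    rw [Finset.sum_multiset_map_count]; rfl
  rw [Multiset.card_Iic, ← Finset.prod_pow, h1, ← Finset.prod_pow_eq_pow_sum]
  calc ∏ b ∈ S.toFinset, (S.count b + 1) ^ 2
      ≤ ∏ b ∈ S.toFinset, (if w b = 1 then 4 else 1) * 2 ^ (S.count b * w b) := by
        refine Finset.prod_le_prod' fun b hb => ?_
        have h2 := hw b (Multiset.mem_toFinset.mp hb)
        split_ifs with h3
        · rw [h3, mul_one]; exact succ_sq_le_four_mul_two_pow _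
        · rw [one_mul]
          -- From weight two on, `4^e` is available and no constant is lost.
          calc (S.count b + 1) ^ 2 ≤ (2 ^ S.count b) ^ 2 :=
                Nat.pow_le_pow_left (Nat.succ_le_of_lt Nat.lt_two_pow_self) 2
            _ = 2 ^ (S.count b * 2) := by rw [pow_mul]
            _ ≤ _ := Nat.pow_le_pow_right (by norm_num) (Nat.mul_le_mul_left _ (by omega))
    _ = 4 ^ (S.toFinset.filter fun b => w b = 1).card * ∏ b ∈ S.toFinset, 2 ^ (S.count b * w b) := by
        rw [Finset.prod_mul_distrib, Finset.prod_ite, Finset.prod_const, Finset.prod_const_one,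
          mul_one]
    _ ≤ _ := Nat.mul_le_mul_right _ (Nat.pow_le_pow_right (by norm_num) hk)

end Divisors

/-! ### The integers as a finite Dedekind extension of `F[t]`. -/

namespace IsImaginaryQuadratic

variable {F K : Type*} [Field F] [Field K] [Algebra F[X] K] [Algebra (RatFunc F) K]
  {α : F[X]} {s : K} {v : AbsoluteValue K ℝ}
  [IsScalarTower F[X] (RatFunc F) K] [Finite F]

local notation "ι" => algebraMap (RatFunc F) K
local notation "κ" => algebraMap (Polynomial F) (RatFunc F)
local notation "𝔸" => integralClosure (Polynomial F) K

/-- In odd characteristic `X² - α` is separable. This is the input for `moduleFinite` and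
`isDedekindDomain`. -/
theorem isSeparable (h : IsImaginaryQuadratic α s v) : Algebra.IsSeparable (RatFunc F) K := by
  have h1 : IsSeparable (RatFunc F) s := by
    have h2 : (X ^ 2 - C (κ α)).Separable := by
      apply separable_X_pow_sub_C
      · exact_mod_cast h.two_ne_zero_ratFunc
      · rw [Ne, map_eq_zero_iff _ (IsFractionRing.injective F[X] (RatFunc F))]
        exact h.ne_zero
    refine h2.of_dvd (minpoly.dvd _ _ ?_)
    rw [map_sub, map_pow, aeval_X, aeval_C, h.sq_eq', sub_self]
  have h3 := (IntermediateField.isSeparable_adjoin_simple_iff_isSeparable (RatFunc F) K).mpr h1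
  rw [h.adjoin_eq_top] at h3
  exact AlgEquiv.Algebra.isSeparable IntermediateField.topEquiv

theorem moduleFinite (h : IsImaginaryQuadratic α s v) : Module.Finite F[X] 𝔸 := by
  have := h.finiteDimensional
  have := h.isSeparable
  exact IsIntegralClosure.finite F[X] (RatFunc F) K 𝔸

theorem isDedekindDomain (h : IsImaginaryQuadratic α s v) : IsDedekindDomain 𝔸 := by
  have := h.finiteDimensional
  have := h.isSeparable
  exact integralClosure.isDedekindDomain F[X] (RatFunc F) K

theorem isTorsionFree : Module.IsTorsionFree F[X] 𝔸 := by
  have : FaithfulSMul F[X] K := by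
    rw [faithfulSMul_iff_algebraMap_injective, IsScalarTower.algebraMap_eq F[X] (RatFunc F) K]
    exact (algebraMap (RatFunc F) K).injective.comp (IsFractionRing.injective F[X] (RatFunc F))
  infer_instance

end IsImaginaryQuadratic

/-! ### Degrees of ideal norms and primes of degree one. -/

section Degree

variable {F R : Type*} [Field F] [CommRing R] [IsDedekindDomain R] [Algebra F[X] R]
  [Module.Finite F[X] R] [Module.IsTorsionFree F[X] R]

/-- The degree of the norm of an ideal. -/
def normDegree (I : Ideal R) : ℕ :=
  (Submodule.IsPrincipal.generator (Ideal.relNorm F[X] I)).natDegree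

theorem normDegree_eq {I : Ideal R} {p : F[X]} (hp : Ideal.relNorm F[X] I = Ideal.span {p}) :
    normDegree (F := F) I = p.natDegree := by
  have h1 : Ideal.span {Submodule.IsPrincipal.generator (Ideal.relNorm F[X] I)} =
      Ideal.span {p} := by
    rw [← hp]; exact Ideal.span_singleton_generator _
  rw [Ideal.span_singleton_eq_span_singleton] at h1
  exact natDegree_eq_of_degree_eq (degree_eq_degree_of_associated h1)

theorem exists_relNorm_eq_span (I : Ideal R) (hI : I ≠ ⊥) :
    ∃ p : F[X], p ≠ 0 ∧ Ideal.relNorm F[X] I = Ideal.span {p} := by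
  refine ⟨_, ?_, (Ideal.span_singleton_generator (Ideal.relNorm F[X] I)).symm⟩
  rw [Ne, ← Submodule.IsPrincipal.eq_bot_iff_generator_eq_zero, Ideal.relNorm_eq_bot_iff]
  exact hI

theorem normDegree_one : normDegree (F := F) (1 : Ideal R) = 0 := by
  rw [normDegree_eq (p := 1), natDegree_one]
  rw [map_one, Ideal.span_singleton_one, Ideal.one_eq_top]

theorem normDegree_mul {I J : Ideal R} (hI : I ≠ ⊥) (hJ : J ≠ ⊥) :
    normDegree (F := F) (I * J) = normDegree (F := F) I + normDegree (F := F) J := by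
  obtain ⟨p, hp, hpI⟩ := exists_relNorm_eq_span (F := F) I hI
  obtain ⟨r, hr, hrJ⟩ := exists_relNorm_eq_span (F := F) J hJ
  rw [normDegree_eq hpI, normDegree_eq hrJ, ← natDegree_mul hp hr]
  apply normDegree_eq
  rw [map_mul, hpI, hrJ, Ideal.span_singleton_mul_span_singleton]

theorem normDegree_multiset_prod (S : Multiset (Ideal R)) (hS : ∀ I ∈ S, I ≠ ⊥) :
    normDegree (F := F) S.prod = (S.map (normDegree (F := F))).sum := by
  induction S using Multiset.induction_on with
  | empty => rw [Multiset.prod_zero, normDegree_one, Multiset.map_zero, Multiset.sum_zero]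
  | cons I S ih =>
    rw [Multiset.prod_cons, Multiset.map_cons, Multiset.sum_cons, normDegree_mul, ih]
    · exact fun J hJ => hS J (Multiset.mem_cons_of_mem hJ)
    · exact hS I (Multiset.mem_cons_self _ _)
    · have : S.prod ≠ 0 := by
        apply Multiset.prod_ne_zero
        intro h0
        exact hS 0 (Multiset.mem_cons_of_mem h0) rfl
      exact this

/-- The norm of `P` is contained in `P ∩ F[t]`; a constant nonzero generator would force `1 ∈ P`. -/
theorem normDegree_pos {P : Ideal R} (hP : P ≠ ⊤) (h0 : P ≠ ⊥) : 0 < normDegree (F := F) P := by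
  obtain ⟨p, hp, hpP⟩ := exists_relNorm_eq_span (F := F) P h0
  rw [normDegree_eq hpP]
  by_contra! h1
  have h2 : IsUnit p := by
    rw [natDegree_eq_zero.mp (Nat.le_zero.mp h1) |>.choose_spec.symm]
    apply isUnit_C.mpr
    rw [isUnit_iff_ne_zero]
    rintro h3
    have := (natDegree_eq_zero.mp (Nat.le_zero.mp h1)).choose_spec
    rw [h3, C_0] at this
    exact hp this.symm
  have h3 := Ideal.relNorm_le_comap F[X] P
  rw [hpP, Ideal.span_singleton_eq_top.mpr h2, top_le_iff, Ideal.comap_eq_top_iff] at h3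
  exact hP h3

open UniqueFactorizationMonoid in
theorem normDegree_eq_sum {I : Ideal R} (hI : I ≠ ⊥) :
    normDegree (F := F) I = ((normalizedFactors I).map (normDegree (F := F))).sum := by
  rw [← normDegree_multiset_prod, Ideal.prod_normalizedFactors_eq_self hI]
  intro P hP
  exact (prime_of_normalized_factor P hP).ne_zero

open UniqueFactorizationMonoid in
theorem normDegree_pos_of_mem {I P : Ideal R} (hP : P ∈ normalizedFactors I) :
    0 < normDegree (F := F) P := by
  have h1 := prime_of_normalized_factor P hP
  exact normDegree_pos (by rw [← Ideal.one_eq_top]; exact h1.ne_one) h1.ne_zero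

open UniqueFactorizationMonoid in
theorem card_normalizedFactors_le {I : Ideal R} (hI : I ≠ ⊥) :
    Multiset.card (normalizedFactors I) ≤ normDegree (F := F) I := by
  rw [normDegree_eq_sum hI, ← Multiset.card_map (normDegree (F := F))]
  have := Multiset.card_nsmul_le_sum (s := (normalizedFactors I).map (normDegree (F := F))) (a := 1)
    (by
      intro x hx
      obtain ⟨P, hP, rfl⟩ := Multiset.mem_map.mp hx
      exact normDegree_pos_of_mem hP)
  simpa using this

open UniqueFactorizationMonoid in
/-- If all the ideals `(t - c)` have norms of degree at most `n`, then there are at most `q n` prime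
ideals whose norm has degree one. -/
theorem card_le_of_normDegree_eq_one [Finite F] {n : ℕ}
    (hn : ∀ c : F, normDegree (F := F) (Ideal.span {algebraMap F[X] R (X - C c)}) ≤ n)
    (S : Finset (Ideal R)) (hS : ∀ P ∈ S, Prime P ∧ normDegree (F := F) P = 1) :
    S.card ≤ Nat.card F * n := by
  classical
  have : Fintype F := Fintype.ofFinite F
  have h0 (c : F) : Ideal.span {algebraMap F[X] R (X - C c)} ≠ ⊥ := by
    rw [Ne, Ideal.span_singleton_eq_bot, map_eq_zero_iff _ (FaithfulSMul.algebraMap_injective _ _)]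
    exact X_sub_C_ne_zero c
  have h1 : S ⊆ Finset.univ.biUnion fun c : F =>
      (normalizedFactors (Ideal.span {algebraMap F[X] R (X - C c)})).toFinset := by
    intro P hP
    obtain ⟨hPp, hP1⟩ := hS P hP
    obtain ⟨p, hp, hpP⟩ := exists_relNorm_eq_span (F := F) P hPp.ne_zero
    rw [normDegree_eq hpP] at hP1
    have ha : p.coeff 1 ≠ 0 := by
      rw [← hP1]; simpa using hp
    -- A norm of degree one is a unit times some `t - c`, so `P` contains, hence divides, one of the
    -- `q` ideals `(t - c)`.
    have h2 : p = C (p.coeff 1) * (X - C (-(p.coeff 0 / p.coeff 1))) := by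
      conv_lhs => rw [eq_X_add_C_of_natDegree_le_one hP1.le]
      rw [mul_sub, ← C_mul, mul_neg, mul_div_cancel₀ _ ha, C_neg, sub_neg_eq_add]
    rw [Finset.mem_biUnion]
    refine ⟨-(p.coeff 0 / p.coeff 1), Finset.mem_univ _, ?_⟩
    rw [Multiset.mem_toFinset, Ideal.mem_normalizedFactors_iff (h0 _)]
    refine ⟨Ideal.isPrime_of_prime hPp, ?_⟩
    rw [Ideal.span_singleton_le_iff_mem]
    have h3 : p ∈ P.comap (algebraMap F[X] R) :=
      Ideal.relNorm_le_comap F[X] P (hpP ▸ Ideal.mem_span_singleton_self p)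
    rw [h2] at h3
    exact (Ideal.unit_mul_mem_iff_mem _ (isUnit_C.mpr ha.isUnit)).mp h3
  calc S.card ≤ _ := Finset.card_le_card h1
    _ ≤ Finset.univ.card * n := Finset.card_biUnion_le_card_mul _ _ _ fun c _ =>
      (Multiset.toFinset_card_le _).trans ((card_normalizedFactors_le (F := F) (h0 c)).trans (hn c))
    _ = _ := by rw [Finset.card_univ, Nat.card_eq_fintype_card]

end Degree

/-! ### The divisor bound in `𝔸`. -/

namespace IsImaginaryQuadratic

variable {F K : Type*} [Field F] [Field K] [Algebra F[X] K] [Algebra (RatFunc F) K]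
  {α : F[X]} {s : K} {v : AbsoluteValue K ℝ}
  [IsScalarTower F[X] (RatFunc F) K] [Finite F]

local notation "ι" => algebraMap (RatFunc F) K
local notation "κ" => algebraMap (Polynomial F) (RatFunc F)
local notation "𝔸" => integralClosure (Polynomial F) K

/-- Both sides are the size of the norm of `x`. This converts size at infinity into the total weight
of the prime factorization. -/
theorem abs_sq_eq_pow_normDegree (h : IsImaginaryQuadratic α s v) [IsDedekindDomain 𝔸]
    [Module.Finite F[X] 𝔸] [Module.IsTorsionFree F[X] 𝔸] {x : 𝔸} (hx : x ≠ 0) :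
    v (x : K) ^ 2 = (Nat.card F : ℝ) ^ normDegree (F := F) (Ideal.span {x}) := by
  have := h.finiteDimensional
  have h1 : Ideal.relNorm F[X] (Ideal.span {x}) = Ideal.span {Algebra.intNorm F[X] 𝔸 x} :=
    Ideal.relNorm_singleton F[X] x
  have h2 : κ (Algebra.intNorm F[X] 𝔸 x) = Algebra.norm (RatFunc F) (x : K) :=
    Algebra.algebraMap_intNorm (K := RatFunc F) (L := K) x
  have h3 : Algebra.intNorm F[X] 𝔸 x ≠ 0 := by
    intro h0
    rw [h0, Ideal.span_singleton_eq_bot.mpr rfl, Ideal.relNorm_eq_bot_iff,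
      Ideal.span_singleton_eq_bot] at h1
    exact hx h1
  rw [normDegree_eq h1, h.abs_sq_eq_absInf_norm, ← h2, toKInf_algebraMap, absInf_polyToKInf h3]

theorem abs_sq_le_one_of_isUnit (h : IsImaginaryQuadratic α s v) (u : 𝔸ˣ) :
    v ((u : 𝔸) : K) ^ 2 ≤ 1 := by
  have h1 := h.one_le_abs_sq (x := ((u⁻¹ : 𝔸ˣ) : 𝔸)) u⁻¹.ne_zero
  have h2 : v ((u : 𝔸) : K) ^ 2 * v (((u⁻¹ : 𝔸ˣ) : 𝔸) : K) ^ 2 = 1 := by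
    rw [← mul_pow, ← map_mul, ← Subalgebra.coe_mul, Units.mul_inv, Subalgebra.coe_one, map_one,
      one_pow]
  calc _ ≤ v ((u : 𝔸) : K) ^ 2 * v (((u⁻¹ : 𝔸ˣ) : 𝔸) : K) ^ 2 :=
        le_mul_of_one_le_right (sq_nonneg _) h1
    _ = 1 := h2

theorem finite_divisors (h : IsImaginaryQuadratic α s v) {m : 𝔸} (hm : m ≠ 0) :
    {u : 𝔸 | u ∣ m}.Finite := by
  obtain ⟨M, hM⟩ := pow_unbounded_of_one_lt (v (m : K) ^ 2) (one_lt_card (F := F))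
  refine (h.finite_ballInt M).subset fun u hu => le_trans ?_ hM.le
  obtain ⟨w, rfl⟩ := hu
  have hw : w ≠ 0 := by rintro rfl; simp at hm
  rw [Subalgebra.coe_mul, map_mul, mul_pow]
  exact le_mul_of_one_le_right (sq_nonneg _) (h.one_le_abs_sq hw)

open UniqueFactorizationMonoid in
/-- The divisor bound in `𝔸`. -/
theorem ncard_divisors_le (h : IsImaginaryQuadratic α s v) {m : 𝔸} (hm : m ≠ 0) {Q : ℕ}
    (hmQ : v (m : K) ^ 2 ≤ (Nat.card F : ℝ) ^ (2 * Q)) :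
    {u : 𝔸 | u ∣ m}.ncard ≤ Nat.card F ^ 2 * (4 ^ Nat.card F * 2 ^ Q) := by
  classical
  have := h.isDedekindDomain
  have := h.moduleFinite
  have : Module.IsTorsionFree F[X] 𝔸 := isTorsionFree
  have hq := one_lt_card (F := F)
  have hI : Ideal.span {m} ≠ ⊥ := by rwa [Ne, Ideal.span_singleton_eq_bot]
  have hfin := h.finite_divisors hm
  have hdeg : normDegree (F := F) (Ideal.span {m}) ≤ 2 * Q := by
    rwa [h.abs_sq_eq_pow_normDegree hm, pow_le_pow_iff_right₀ hq] at hmQ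
  -- Since `𝐍(t - c) = q²`, there are at most `2q` primes of degree one.
  have hc (c : F) : normDegree (F := F) (Ideal.span {algebraMap F[X] 𝔸 (X - C c)}) ≤ 2 := by
    have h0 : algebraMap F[X] 𝔸 (X - C c) ≠ 0 := by
      rw [Ne, map_eq_zero_iff _ (FaithfulSMul.algebraMap_injective _ _)]
      exact X_sub_C_ne_zero c
    have h1 := h.abs_sq_eq_pow_normDegree h0
    have h2 : ((algebraMap F[X] 𝔸 (X - C c) : 𝔸) : K) = ι (κ (X - C c)) := by
      rw [← IsScalarTower.algebraMap_apply]; rfl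
    rw [h2, h.abs_algebraMap, toKInf_algebraMap, absInf_polyToKInf (X_sub_C_ne_zero c),
      natDegree_X_sub_C, pow_one] at h1
    exact (pow_right_injective₀ (by positivity) hq.ne' h1).ge
  have h1 : (Finset.Iic (normalizedFactors (Ideal.span {m}))).card ≤ 4 ^ Nat.card F * 2 ^ Q := by
    rw [← Nat.pow_le_pow_iff_left (n := 2) (by norm_num)]
    calc _ ≤ 4 ^ (Nat.card F * 2) * 2 ^ normDegree (F := F) (Ideal.span {m}) := by
          rw [normDegree_eq_sum hI]
          apply card_Iic_sq_le
          · intro P hP; exact normDegree_pos_of_mem hP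
          · apply card_le_of_normDegree_eq_one hc
            intro P hP
            rw [Finset.mem_filter, Multiset.mem_toFinset] at hP
            exact ⟨prime_of_normalized_factor P hP.1, hP.2⟩
      _ ≤ 4 ^ (Nat.card F * 2) * 2 ^ (Q * 2) := by
          gcongr
          · norm_num
          · omega
      _ = _ := by rw [mul_pow, pow_mul, pow_mul]
  rw [Set.ncard_eq_toFinset_card _ hfin]
  -- Divisors are counted through the ideals they generate; each fibre is one orbit of units, and
  -- units lie in the ball of radius `1`, of size at most `q²`.
  refine (Finset.card_le_mul_card_image_of_maps_to
    (f := fun u : 𝔸 => normalizedFactors (Ideal.span {u}))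
    (t := Finset.Iic (normalizedFactors (Ideal.span {m}))) ?_ (Nat.card F ^ 2) ?_).trans
      (Nat.mul_le_mul_left _ h1)
  · intro u hu
    rw [Set.Finite.mem_toFinset] at hu
    have hu0 : u ≠ 0 := by rintro rfl; exact hm (zero_dvd_iff.mp hu)
    rw [Finset.mem_Iic, ← dvd_iff_normalizedFactors_le_normalizedFactors _ hI]
    · rw [Ideal.dvd_span_singleton, Ideal.mem_span_singleton]
      exact hu
    · rwa [Ne, Ideal.zero_eq_bot, Ideal.span_singleton_eq_bot]
  · intro T _
    rcases (hfin.toFinset.filter fun u : 𝔸 => normalizedFactors (Ideal.span {u}) = T).eq_empty_or_nonempty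
      with h0 | ⟨u₀, hu₀⟩
    · rw [h0, Finset.card_empty]; exact Nat.zero_le _
    have hne {u : 𝔸} (hu : u ∈ hfin.toFinset) : Ideal.span {u} ≠ ⊥ := by
      rw [Set.Finite.mem_toFinset] at hu
      rw [Ne, Ideal.span_singleton_eq_bot]
      rintro rfl
      exact hm (zero_dvd_iff.mp hu)
    rw [Finset.mem_filter] at hu₀
    have h2 : ((hfin.toFinset.filter fun u : 𝔸 => normalizedFactors (Ideal.span {u}) = T : Finset 𝔸) :
        Set 𝔸) ⊆ (fun w => u₀ * w) '' ballInt (F := F) v 0 := by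
      intro u hu
      rw [Finset.mem_coe, Finset.mem_filter] at hu
      have h3 : Ideal.span {u₀} = Ideal.span {u} := by
        rw [← Ideal.prod_normalizedFactors_eq_self (hne hu₀.1),
          ← Ideal.prod_normalizedFactors_eq_self (hne hu.1), hu.2, hu₀.2]
      rw [Ideal.span_singleton_eq_span_singleton] at h3
      obtain ⟨w, rfl⟩ := h3
      refine ⟨w, ?_, rfl⟩
      rw [ballInt, Set.mem_ofPred_eq, pow_zero]
      exact h.abs_sq_le_one_of_isUnit w
    rw [← Set.ncard_coe_finset]
    calc _ ≤ _ := Set.ncard_le_ncard h2 ((h.finite_ballInt 0).image _)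
      _ ≤ _ := Set.ncard_image_le (h.finite_ballInt 0)
      _ ≤ _ := h.ncard_ballInt_le 0

end IsImaginaryQuadratic

/-! ### Counting the fractions that share a character. -/

namespace IsImaginaryQuadratic

variable {F K : Type*} [Field F] [Field K] [Algebra F[X] K] [Algebra (RatFunc F) K]
  {α : F[X]} {s : K} {v : AbsoluteValue K ℝ}
  [IsScalarTower F[X] (RatFunc F) K] [Finite F]

local notation "𝔸" => integralClosure (Polynomial F) K

theorem zpow_le_pow_toNat (z : ℤ) : (Nat.card F : ℝ) ^ z ≤ (Nat.card F : ℝ) ^ z.toNat := by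
  rw [← zpow_natCast]
  exact zpow_le_zpow_right₀ (one_lt_card (F := F)).le (Int.self_le_toNat z)

/-- The integer `w` near `c.out / f² - x` is absorbed by passing to the representative `c.out - w
f²`; clearing `f²` scales the error by `q^(2Q)`. -/
theorem exists_mk_eq_of_pairingChar_eq (h : IsImaginaryQuadratic α s v) {Q N : ℕ} {f : 𝔸}
    (hf : f ∈ moduli (F := F) v Q) {x : K} {c : 𝔸 ⧸ Ideal.span {f ^ 2}}
    (hc : h.pairingChar N ((c.out : K) / (f : K) ^ 2) = h.pairingChar N x) :
    ∃ r : 𝔸, Ideal.Quotient.mk _ r = c ∧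
      v (r - (f : K) ^ 2 * x) ^ 2 ≤ (Nat.card F : ℝ) ^ (2 * (Q : ℤ) + α.natDegree - N) := by
  have hq := one_lt_card (F := F)
  obtain ⟨w, hw⟩ := h.exists_abs_sub_sq_le_of_pairingChar_eq hc
  have hf0 : (f : K) ≠ 0 := by simpa using hf.1
  refine ⟨c.out - w * f ^ 2, ?_, ?_⟩
  · refine Eq.trans ?_ (Quotient.out_eq c)
    refine Ideal.Quotient.eq.mpr ?_
    rw [Ideal.mem_span_singleton]
    exact ⟨-w, by ring⟩
  · have h1 : ((c.out - w * f ^ 2 : 𝔸) : K) - (f : K) ^ 2 * x =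
        (f : K) ^ 2 * ((c.out : K) / (f : K) ^ 2 - x - w) := by
      push_cast
      field_simp
      ring
    rw [h1, map_mul, map_pow, mul_pow, hf.2]
    calc _ ≤ ((Nat.card F : ℝ) ^ Q) ^ 2 * (Nat.card F : ℝ) ^ ((α.natDegree : ℤ) - N) := by gcongr
      _ = _ := by
        rw [← pow_mul, ← zpow_natCast, ← zpow_add₀ (by positivity)]
        congr 1
        push_cast
        ring

/-- All these classes have representatives near the same point `f² x`, so they differ from a fixed
one by elements of a small ball. -/
theorem ncard_pairingChar_eq_le (h : IsImaginaryQuadratic α s v) {Q N : ℕ} {f : 𝔸}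
    (hf : f ∈ moduli (F := F) v Q) (x : K) :
    {c : 𝔸 ⧸ Ideal.span {f ^ 2} |
      h.pairingChar N ((c.out : K) / (f : K) ^ 2) = h.pairingChar N x}.ncard ≤
      Nat.card F ^ ((2 * (Q : ℤ) + α.natDegree - N).toNat + 2) := by
  set T := {c : 𝔸 ⧸ Ideal.span {f ^ 2} |
      h.pairingChar N ((c.out : K) / (f : K) ^ 2) = h.pairingChar N x} with hT
  set M := (2 * (Q : ℤ) + α.natDegree - N).toNat with hM
  rcases T.eq_empty_or_nonempty with h0 | ⟨c₁, hc₁⟩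
  · rw [h0, Set.ncard_empty]; exact Nat.zero_le _
  obtain ⟨r₁, -, hr₁⟩ := h.exists_mk_eq_of_pairingChar_eq hf hc₁
  have h1 : T ⊆ (fun b : 𝔸 => Ideal.Quotient.mk (Ideal.span {f ^ 2}) (r₁ + b)) ''
      ballInt (F := F) v M := by
    intro c hc
    obtain ⟨r, hrc, hr⟩ := h.exists_mk_eq_of_pairingChar_eq hf hc
    refine ⟨r - r₁, ?_, by rw [← hrc]; exact congrArg _ (add_sub_cancel r₁ r)⟩
    rw [ballInt, Set.mem_ofPred_eq]
    have h2 : ((r - r₁ : 𝔸) : K) = ((r : K) - (f : K) ^ 2 * x) - (r₁ - (f : K) ^ 2 * x) := by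
      push_cast; ring
    rw [h2]
    exact (h.abs_sq_sub_le hr hr₁).trans (zpow_le_pow_toNat _)
  calc _ ≤ _ := Set.ncard_le_ncard h1 ((h.finite_ballInt M).image _)
    _ ≤ _ := Set.ncard_image_le (h.finite_ballInt M)
    _ ≤ _ := h.ncard_ballInt_le M

/-- The integers `m` with `𝐍(m) ≤ q ^ (2 Q)` for which `m x` is close to an integer. -/
theorem ncard_multipliers_le (h : IsImaginaryQuadratic α s v) {Q N : ℕ} {f₀ r₀ : 𝔸}
    (hf₀ : f₀ ∈ moduli (F := F) v Q) (hr₀ : IsCoprime r₀ f₀) :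
    {m : 𝔸 | m ∈ ballInt (F := F) v (2 * Q) ∧
      ∃ r : 𝔸, v (r - (m : K) * ((r₀ : K) / (f₀ : K) ^ 2)) ^ 2 ≤
        (Nat.card F : ℝ) ^ (2 * (Q : ℤ) + α.natDegree - N)}.ncard ≤
      Nat.card F ^ 2 * Nat.card F ^ ((4 * (Q : ℤ) + α.natDegree - N).toNat + 2) := by
  classical
  have hq := one_lt_card (F := F)
  set T := {m : 𝔸 | m ∈ ballInt (F := F) v (2 * Q) ∧
      ∃ r : 𝔸, v (r - (m : K) * ((r₀ : K) / (f₀ : K) ^ 2)) ^ 2 ≤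
        (Nat.card F : ℝ) ^ (2 * (Q : ℤ) + α.natDegree - N)} with hT
  set M := (4 * (Q : ℤ) + α.natDegree - N).toNat with hM
  have hf0 : (f₀ : K) ≠ 0 := by simpa using hf₀.1
  have hfin : T.Finite := (h.finite_ballInt (2 * Q)).subset fun m hm => hm.1
  have hr (m : 𝔸) : ∃ r : 𝔸, m ∈ T → v (r - (m : K) * ((r₀ : K) / (f₀ : K) ^ 2)) ^ 2 ≤
        (Nat.card F : ℝ) ^ (2 * (Q : ℤ) + α.natDegree - N) := by
    by_cases hm : m ∈ T
    · obtain ⟨r, hr⟩ := hm.2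
      exact ⟨r, fun _ => hr⟩
    · exact ⟨0, fun hm' => absurd hm' hm⟩
  choose ρ hρ using hr
  have hball := h.finite_ballInt (F := F) M
  rw [Set.ncard_eq_toFinset_card _ hfin]
  -- Clearing `f₀²` sends `m` to a small integer congruent to `-m r₀` modulo `f₀²`.
  refine (Finset.card_le_mul_card_image_of_maps_to (f := fun m : 𝔸 => ρ m * f₀ ^ 2 - m * r₀)
    (t := hball.toFinset) ?_ (Nat.card F ^ 2) ?_).trans (Nat.mul_le_mul_left _ ?_)
  · intro m hm
    rw [Set.Finite.mem_toFinset] at hm ⊢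
    have h1 : ((ρ m * f₀ ^ 2 - m * r₀ : 𝔸) : K) =
        (f₀ : K) ^ 2 * (ρ m - (m : K) * ((r₀ : K) / (f₀ : K) ^ 2)) := by
      push_cast; field_simp
    rw [ballInt, Set.mem_ofPred_eq, h1, map_mul, map_pow, mul_pow, hf₀.2]
    refine le_trans ?_ (zpow_le_pow_toNat _)
    calc _ ≤ ((Nat.card F : ℝ) ^ Q) ^ 2 * (Nat.card F : ℝ) ^ (2 * (Q : ℤ) + α.natDegree - N) := by
          gcongr
          exact hρ m hm
      _ = _ := by
        rw [← pow_mul, ← zpow_natCast, ← zpow_add₀ (by positivity)]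
        congr 1
        push_cast
        ring
  · intro b _
    rcases (hfin.toFinset.filter fun m : 𝔸 => ρ m * f₀ ^ 2 - m * r₀ = b).eq_empty_or_nonempty
      with h0 | ⟨m₁, hm₁⟩
    · rw [h0, Finset.card_empty]; exact Nat.zero_le _
    rw [Finset.mem_filter, Set.Finite.mem_toFinset] at hm₁
    have h2 : ((hfin.toFinset.filter fun m : 𝔸 => ρ m * f₀ ^ 2 - m * r₀ = b : Finset 𝔸) :
        Set 𝔸) ⊆ (fun k => m₁ + f₀ ^ 2 * k) '' ballInt (F := F) v 0 := by
      intro m hm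
      rw [Finset.mem_coe, Finset.mem_filter, Set.Finite.mem_toFinset] at hm
      -- Coprimality enters here: equal images force `m ≡ m₁` modulo `f₀²`, and `𝐍(m - m₁) ≤ q^(2Q)
      -- = 𝐍(f₀²)` leaves only a bounded quotient `k`.
      have h3 : f₀ ^ 2 ∣ m - m₁ := by
        apply (hr₀.symm.pow_left (m := 2)).dvd_of_dvd_mul_right
        exact ⟨ρ m - ρ m₁, by linear_combination hm₁.2 - hm.2⟩
      obtain ⟨k, hk⟩ := h3
      refine ⟨k, ?_, by linear_combination -hk⟩
      have h4 : v ((m - m₁ : 𝔸) : K) ^ 2 ≤ (Nat.card F : ℝ) ^ (2 * Q) := by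
        push_cast
        exact h.abs_sq_sub_le hm.1.1 hm₁.1.1
      rw [hk] at h4
      push_cast at h4
      rw [map_mul, map_pow, mul_pow, hf₀.2, ← pow_mul, mul_comm Q] at h4
      rw [ballInt, Set.mem_ofPred_eq, pow_zero]
      exact le_of_mul_le_mul_left (by rwa [mul_one]) (by positivity)
    rw [← Set.ncard_coe_finset]
    calc _ ≤ _ := Set.ncard_le_ncard h2 ((h.finite_ballInt 0).image _)
      _ ≤ _ := Set.ncard_image_le (h.finite_ballInt 0)
      _ ≤ _ := h.ncard_ballInt_le 0
  · rw [← Set.ncard_eq_toFinset_card _ hball]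
    exact h.ncard_ballInt_le M

/-- Square differencing: the number of moduli `f` for which `f² x` is close to an integer is
controlled by the multipliers `m = f₁² - f₂²` and their divisors `f₁ - f₂`. -/
theorem card_sq_le (h : IsImaginaryQuadratic α s v) {Q N : ℕ} {f₀ r₀ : 𝔸}
    (hf₀ : f₀ ∈ moduli (F := F) v Q) (hr₀ : IsCoprime r₀ f₀) (S : Finset 𝔸)
    (hS : ∀ f ∈ S, f ∈ moduli (F := F) v Q ∧ ∃ r : 𝔸,
      v (r - (f : K) ^ 2 * ((r₀ : K) / (f₀ : K) ^ 2)) ^ 2 ≤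
        (Nat.card F : ℝ) ^ (2 * (Q : ℤ) + α.natDegree - N)) :
    S.card ^ 2 ≤ 2 * S.card + Nat.card F ^ 2 * (4 ^ Nat.card F * 2 ^ Q) *
      (Nat.card F ^ 2 * Nat.card F ^ ((4 * (Q : ℤ) + α.natDegree - N).toNat + 2)) := by
  classical
  set T := {m : 𝔸 | m ∈ ballInt (F := F) v (2 * Q) ∧
      ∃ r : 𝔸, v (r - (m : K) * ((r₀ : K) / (f₀ : K) ^ 2)) ^ 2 ≤
        (Nat.card F : ℝ) ^ (2 * (Q : ℤ) + α.natDegree - N)} with hT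
  have hfin : T.Finite := (h.finite_ballInt (2 * Q)).subset fun m hm => hm.1
  have h2 : (2 : 𝔸) ≠ 0 := by
    intro h0
    exact h.two_ne_zero (congrArg (Subtype.val) h0)
  rw [pow_two, ← Finset.card_product,
    ← Finset.card_filter_add_card_filter_not (fun p : 𝔸 × 𝔸 => p.1 ^ 2 = p.2 ^ 2)]
  apply add_le_add
  · have h3 : (S ×ˢ S).filter (fun p : 𝔸 × 𝔸 => p.1 ^ 2 = p.2 ^ 2) ⊆
        S.image (fun f => (f, f)) ∪ S.image (fun f => (-f, f)) := by
      rintro ⟨f₁, f₂⟩ hp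
      rw [Finset.mem_filter, Finset.mem_product] at hp
      rw [Finset.mem_union, Finset.mem_image, Finset.mem_image]
      rcases sq_eq_sq_iff_eq_or_eq_neg.mp hp.2 with h4 | h4
      · exact Or.inl ⟨f₂, hp.1.2, Prod.ext h4.symm rfl⟩
      · exact Or.inr ⟨f₂, hp.1.2, Prod.ext h4.symm rfl⟩
    calc _ ≤ _ := Finset.card_le_card h3
      _ ≤ _ := Finset.card_union_le _ _
      _ ≤ S.card + S.card := add_le_add Finset.card_image_le Finset.card_image_le
      _ = _ := (two_mul _).symm
  · have hmem : ∀ p ∈ (S ×ˢ S).filter (fun p : 𝔸 × 𝔸 => ¬ p.1 ^ 2 = p.2 ^ 2),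
        p.1 ^ 2 - p.2 ^ 2 ∈ hfin.toFinset.filter (· ≠ 0) := by
      rintro ⟨f₁, f₂⟩ hp
      rw [Finset.mem_filter, Finset.mem_product] at hp
      obtain ⟨hf₁, r₁, hr₁⟩ := hS f₁ hp.1.1
      obtain ⟨hf₂, r₂, hr₂⟩ := hS f₂ hp.1.2
      rw [Finset.mem_filter, Set.Finite.mem_toFinset]
      refine ⟨⟨?_, r₁ - r₂, ?_⟩, sub_ne_zero.mpr hp.2⟩
      · rw [ballInt, Set.mem_ofPred_eq]
        push_cast
        apply h.abs_sq_sub_le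
        · rw [map_pow, hf₁.2, ← pow_mul, mul_comm]
        · rw [map_pow, hf₂.2, ← pow_mul, mul_comm]
      · have h5 : ((r₁ - r₂ : 𝔸) : K) - ((f₁ ^ 2 - f₂ ^ 2 : 𝔸) : K) * ((r₀ : K) / (f₀ : K) ^ 2) =
            (r₁ - (f₁ : K) ^ 2 * ((r₀ : K) / (f₀ : K) ^ 2)) -
            (r₂ - (f₂ : K) ^ 2 * ((r₀ : K) / (f₀ : K) ^ 2)) := by
          push_cast; ring
        rw [h5]
        exact h.abs_sq_sub_le hr₁ hr₂
    refine (Finset.card_le_mul_card_image_of_maps_to hmem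
      (Nat.card F ^ 2 * (4 ^ Nat.card F * 2 ^ Q)) ?_).trans (Nat.mul_le_mul_left _ ?_)
    · intro m hm
      rw [Finset.mem_filter, Set.Finite.mem_toFinset] at hm
      have hdiv := h.finite_divisors hm.2
      refine le_trans ?_ (h.ncard_divisors_le hm.2 hm.1.1)
      rw [← Set.ncard_coe_finset]
      -- The divisor `f₁ - f₂` of `m ≠ 0` determines the cofactor `f₁ + f₂` and then, as `2 ≠ 0`,
      -- the pair.
      refine Set.ncard_le_ncard_of_injOn (fun p : 𝔸 × 𝔸 => p.1 - p.2) ?_ ?_ hdiv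
      · rintro ⟨f₁, f₂⟩ hp
        rw [Finset.mem_coe, Finset.mem_filter] at hp
        exact ⟨f₁ + f₂, by rw [← hp.2]; ring⟩
      · rintro ⟨f₁, f₂⟩ hp ⟨g₁, g₂⟩ hp' huv
        rw [Finset.mem_coe, Finset.mem_filter] at hp hp'
        simp only at huv hp hp'
        have h6 : f₁ - f₂ ≠ 0 := by
          intro h0
          apply hm.2
          rw [← hp.2]
          linear_combination (f₁ + f₂) * h0
        have h7 : f₁ + f₂ = g₁ + g₂ := by
          apply mul_left_cancel₀ h6
          linear_combination hp.2 - hp'.2 - (g₁ + g₂) * huv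
        have h8 : f₁ = g₁ := by
          apply mul_left_cancel₀ h2
          linear_combination huv + h7
        rw [Prod.mk.injEq]
        exact ⟨h8, by rw [h8] at h7; exact add_left_cancel h7⟩
    · refine (Finset.card_filter_le _ _).trans ?_
      rw [← Set.ncard_eq_toFinset_card _ hfin]
      exact h.ncard_multipliers_le hf₀ hr₀

end IsImaginaryQuadratic

/-- Completing the square, `(x - 1)² ≤ 1 + y² ≤ (1 + y)²`. -/
theorem le_two_add_of_sq_le {x y : ℝ} (hy : 0 ≤ y) (h : x ^ 2 ≤ 2 * x + y ^ 2) :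
    x ≤ 2 + y := by
  nlinarith

/-! ### The two ranges of `N`. -/

namespace IsImaginaryQuadratic

variable {F K : Type*} [Field F] [Field K] [Algebra F[X] K] [Algebra (RatFunc F) K]
  {α : F[X]} {s : K} {v : AbsoluteValue K ℝ}
  [IsScalarTower F[X] (RatFunc F) K] [Finite F]

local notation "𝔸" => integralClosure (Polynomial F) K

/-- The large sieve in the range `N ≤ 2 Q`. -/
theorem sieveSum_le_of_le (h : IsImaginaryQuadratic α s v) {Q N : ℕ} (hN : N ≤ 2 * Q) (a : 𝔸 → ℂ) :
    sieveSum v s Q N a ≤ (Nat.card F : ℝ) ^ (α.natDegree + 6) * (Nat.card F : ℝ) ^ (3 * Q) *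
      ∑ᶠ g ∈ ballInt (F := F) v N, ‖a g‖ ^ 2 := by
  have hmod := h.finite_moduli Q
  set B : ℝ := (Nat.card F : ℝ) ^ (Q + 2) *
    (Nat.card F : ℝ) ^ ((2 * (Q : ℤ) + α.natDegree - N).toNat + 2) with hB
  have h1 := h.sieveSum_le Q N a B (by positivity) (fun f₀ hf₀ r₀ hr₀ =>
    ⟨hmod.toFinset, Nat.card F ^ ((2 * (Q : ℤ) + α.natDegree - N).toNat + 2), ?_, fun f hf =>
      ⟨h.ncard_pairingChar_eq_le hf _, fun _ => hmod.mem_toFinset.mpr hf⟩⟩)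
  · refine h1.trans ?_
    rw [← mul_assoc]
    apply mul_le_mul_of_nonneg_right _ (finsum_nonneg fun _ => finsum_nonneg fun _ => sq_nonneg _)
    calc B * (ballInt (F := F) v N).ncard ≤ B * (Nat.card F : ℝ) ^ (N + 2) := by
          apply mul_le_mul_of_nonneg_left _ (by positivity)
          exact_mod_cast h.ncard_ballInt_le N
      _ = _ := by
          -- As `N ≤ 2Q`, the truncation is inactive and `N` cancels: `(Q+2) + (2Q+d-N+2) + (N+2) =
          -- 3Q+d+6`.
          rw [hB, ← pow_add, ← pow_add, ← pow_add]
          congr 1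
          omega
  · rw [hB, Nat.cast_pow]
    apply mul_le_mul_of_nonneg_right _ (by positivity)
    rw [← Set.ncard_eq_toFinset_card _ hmod]
    exact_mod_cast (Set.ncard_le_ncard (moduli_subset_ballInt Q) (h.finite_ballInt Q)).trans
      (h.ncard_ballInt_le Q)

/-- The root is `1` when the exponent truncates and `q^(d/2) q^(2Q-N/2)` otherwise; the sum covers
both cases. -/
theorem sqrt_rpow_toNat_le {q : ℝ} (hq : 1 ≤ q) (d Q N : ℕ) :
    √(q ^ (4 * (Q : ℤ) + d - N).toNat) ≤ q ^ d * (1 + q ^ (2 * (Q : ℝ) - N / 2)) := by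
  have hq0 : 0 < q := by positivity
  have h2 : (1 : ℝ) ≤ q ^ d := one_le_pow₀ hq
  rcases le_or_gt (4 * (Q : ℤ) + d) N with h1 | h1
  · rw [Int.toNat_of_nonpos (by omega), pow_zero, Real.sqrt_one]
    nlinarith [Real.rpow_pos_of_pos hq0 (2 * (Q : ℝ) - N / 2)]
  · have h3 : ((4 * (Q : ℤ) + d - N).toNat : ℝ) = 4 * Q + d - N := by
      rw [← Int.cast_natCast, Int.toNat_of_nonneg (by omega)]
      push_cast
      ring
    calc √(q ^ (4 * (Q : ℤ) + d - N).toNat) = q ^ ((d : ℝ) / 2 + (2 * (Q : ℝ) - N / 2)) := by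
          rw [← Real.rpow_natCast, h3, Real.sqrt_eq_rpow, ← Real.rpow_mul hq0.le]
          congr 1
          ring
      _ = q ^ ((d : ℝ) / 2) * q ^ (2 * (Q : ℝ) - N / 2) := Real.rpow_add hq0 _ _
      _ ≤ q ^ (d : ℝ) * (1 + q ^ (2 * (Q : ℝ) - N / 2)) := by
          gcongr
          · have := Nat.cast_nonneg (α := ℝ) d
            linarith
          · linarith
      _ = _ := by rw [Real.rpow_natCast]

/-- The large sieve in the range `2 Q ≤ N`. -/
theorem sieveSum_le_of_ge (h : IsImaginaryQuadratic α s v) {Q N : ℕ} (hN : 2 * Q ≤ N) (a : 𝔸 → ℂ) :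
    sieveSum v s Q N a ≤
      (2 + (Nat.card F : ℝ) ^ (α.natDegree + 3) * 2 ^ Nat.card F) *
        (Nat.card F : ℝ) ^ (α.natDegree + 4) *
      ((2 : ℝ) ^ (((N : ℝ) - Q) / 2) * ((Nat.card F : ℝ) ^ ((Q : ℝ) / 2 + N) +
        (Nat.card F : ℝ) ^ (2 * (Q : ℝ) + N / 2))) *
      ∑ᶠ g ∈ ballInt (F := F) v N, ‖a g‖ ^ 2 := by
  classical
  have hq := one_lt_card (F := F)
  have hmod := h.finite_moduli Q
  set q : ℝ := (Nat.card F : ℝ) with hqdef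
  have hq0 : 0 < q := by positivity
  set W : ℝ := (2 : ℝ) ^ (((N : ℝ) - Q) / 2) with hW
  set Z : ℝ := 1 + q ^ (2 * (Q : ℝ) - N / 2) with hZ
  have hNQ : (2 * Q : ℝ) ≤ N := by exact_mod_cast hN
  have hQ0 : (0 : ℝ) ≤ Q := Nat.cast_nonneg Q
  have hW1 : 1 ≤ W := Real.one_le_rpow (by norm_num) (by linarith)
  have hZ1 : 1 ≤ Z := by
    have := Real.rpow_pos_of_pos hq0 (2 * (Q : ℝ) - N / 2)
    linarith
  set B : ℝ := (2 + q ^ (α.natDegree + 3) * 2 ^ Nat.card F) * (W * Z) * q ^ (α.natDegree + 2) with hB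
  have h1 := h.sieveSum_le Q N a B (by positivity) (fun f₀ hf₀ r₀ hr₀ => by
    let S : Finset 𝔸 := hmod.toFinset.filter fun f => ∃ r : 𝔸,
      v (r - (f : K) ^ 2 * ((r₀ : K) / (f₀ : K) ^ 2)) ^ 2 ≤
        (Nat.card F : ℝ) ^ (2 * (Q : ℤ) + α.natDegree - N)
    refine ⟨S, Nat.card F ^ ((2 * (Q : ℤ) + α.natDegree - N).toNat + 2), ?_, fun f hf =>
      ⟨h.ncard_pairingChar_eq_le hf _, ?_⟩⟩
    · have h2 := h.card_sq_le (N := N) hf₀ hr₀ S (fun f hf => by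
        rwa [Finset.mem_filter, Set.Finite.mem_toFinset] at hf)
      have h3 : (S.card : ℝ) ≤ 2 + q ^ 3 * 2 ^ Nat.card F * (W * (q ^ α.natDegree * Z)) := by
        apply le_two_add_of_sq_le (by positivity)
        set T := (4 * (Q : ℤ) + α.natDegree - N).toNat with hT
        have h4 : (S.card : ℝ) ^ 2 ≤ 2 * S.card +
            q ^ 2 * (4 ^ Nat.card F * 2 ^ Q) * (q ^ 2 * q ^ (T + 2)) := by
          rw [hqdef]; exact_mod_cast h2
        refine h4.trans ?_
        gcongr
        -- This is `Q ≤ N - Q`; the factor `2^((N-Q)/2)` pays for the divisor bound.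
        have h5 : (2 : ℝ) ^ Q ≤ W ^ 2 := by
          rw [hW, ← Real.rpow_natCast, ← Real.rpow_natCast, ← Real.rpow_mul (by norm_num)]
          apply Real.rpow_le_rpow_of_exponent_le (by norm_num)
          push_cast
          linarith
        have h6 : q ^ T ≤ (q ^ α.natDegree * Z) ^ 2 := by
          rw [← Real.sqrt_le_left (by positivity)]
          exact sqrt_rpow_toNat_le hq.le _ _ _
        calc q ^ 2 * (4 ^ Nat.card F * 2 ^ Q) * (q ^ 2 * q ^ (T + 2))
            = q ^ 6 * 4 ^ Nat.card F * (2 ^ Q * q ^ T) := by ring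
          _ ≤ q ^ 6 * 4 ^ Nat.card F * (W ^ 2 * (q ^ α.natDegree * Z) ^ 2) := by gcongr
          _ = _ := by
            rw [show (4 : ℝ) = 2 ^ 2 by norm_num, ← pow_mul, mul_comm 2 (Nat.card F), pow_mul]
            ring
      rw [hB]
      have hWZ : 1 ≤ W * Z := one_le_mul_of_one_le_of_one_le hW1 hZ1
      apply mul_le_mul
      · refine h3.trans ?_
        calc 2 + q ^ 3 * 2 ^ Nat.card F * (W * (q ^ α.natDegree * Z))
            ≤ 2 * (W * Z) + q ^ 3 * 2 ^ Nat.card F * (W * (q ^ α.natDegree * Z)) := by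
              gcongr; linarith
          _ = _ := by ring
      · rw [Nat.cast_pow]
        -- Here `2Q ≤ N` bounds the truncated exponent by `d`, so each modulus contributes boundedly
        -- many classes.
        exact pow_le_pow_right₀ hq.le (by omega)
      · positivity
      · positivity
    · rintro ⟨c, hc⟩
      obtain ⟨r, -, hr⟩ := h.exists_mk_eq_of_pairingChar_eq hf hc
      rw [Finset.mem_filter, Set.Finite.mem_toFinset]
      exact ⟨hf, r, hr⟩)
  refine h1.trans ?_
  rw [← mul_assoc]
  apply mul_le_mul_of_nonneg_right _ (finsum_nonneg fun _ => finsum_nonneg fun _ => sq_nonneg _)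
  -- The product equals `q^N + q^(2Q+N/2)`; the factor `q^(Q/2)` in the first target term is slack.
  have h7 : Z * q ^ N ≤ q ^ ((Q : ℝ) / 2 + N) + q ^ (2 * (Q : ℝ) + N / 2) := by
    rw [hZ, add_mul, one_mul, ← Real.rpow_natCast, ← Real.rpow_add hq0]
    apply add_le_add
    · exact Real.rpow_le_rpow_of_exponent_le hq.le (by linarith)
    · apply le_of_eq
      congr 1
      ring
  calc B * (ballInt (F := F) v N).ncard ≤ B * q ^ (N + 2) := by
        apply mul_le_mul_of_nonneg_left _ (by positivity)
        rw [hqdef]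
        exact_mod_cast h.ncard_ballInt_le N
    _ = (2 + q ^ (α.natDegree + 3) * 2 ^ Nat.card F) * q ^ (α.natDegree + 4) *
        (W * (Z * q ^ N)) := by rw [hB]; ring
    _ ≤ _ := by gcongr

end IsImaginaryQuadratic

end SquareSieve
end

theorem theorem2 (q d : ℕ) :
    ∃ C : ℝ, 0 < C ∧
      ∀ (F : Type*) [Field F] [Finite F] (_ : Nat.card F = q) (_ : 2 < ringChar F)
        (α : Polynomial F) (_ : Squarefree α) (_ : α.natDegree = d)
        (_ : Odd α.natDegree ∨ ¬ IsSquare α.leadingCoeff)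
        -- `K = k(√α)`, where `k = F(t)` and `s = √α`
        (K : Type*) [Field K] [Algebra (Polynomial F) K] [Algebra (RatFunc F) K]
        [IsScalarTower (Polynomial F) (RatFunc F) K]
        (s : K) (_ : s ^ 2 = algebraMap (Polynomial F) K α)
        (_ : IntermediateField.adjoin (RatFunc F) {s} = ⊤)
        -- the absolute value of a place of `K` above infinity, extending the one on `k`
        (v : AbsoluteValue K ℝ)
        (_ : ∀ x : RatFunc F,
          v (algebraMap (RatFunc F) K x) = SquareSieve.absInf (SquareSieve.toKInf F x))
        (Q N : ℕ) (a : integralClosure (Polynomial F) K → ℂ),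
        -- all the sums below are finite
        (SquareSieve.moduli (F := F) v Q).Finite ∧
        (SquareSieve.ballInt (F := F) v N).Finite ∧
        (∀ f ∈ SquareSieve.moduli (F := F) v Q,
          Finite (integralClosure (Polynomial F) K ⧸ Ideal.span {f ^ 2})) ∧
        SquareSieve.sieveSum v s Q N a ≤
          C * ((q : ℝ) ^ (3 * Q) + (2 : ℝ) ^ (((N : ℝ) - (Q : ℝ)) / 2) *
              ((q : ℝ) ^ ((Q : ℝ) / 2 + (N : ℝ)) + (q : ℝ) ^ (2 * (Q : ℝ) + (N : ℝ) / 2))) *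
            ∑ᶠ g ∈ SquareSieve.ballInt (F := F) v N, ‖a g‖ ^ 2 := by

  -- The constants of the two ranges are added; the final `1` gives positivity even for `q = 0`,
  -- since `q` is fixed before any field is.
  refine ⟨(q : ℝ) ^ (d + 6) + (2 + (q : ℝ) ^ (d + 3) * 2 ^ q) * (q : ℝ) ^ (d + 4) + 1,
    by positivity, ?_⟩
  intro F _ _ hF hchar α hsf hd hα K _ _ _ _ s hs hadj v hv Q N a
  have h : SquareSieve.IsImaginaryQuadratic α s v := ⟨hchar, hsf, hα, hs, hadj, hv⟩
  refine ⟨h.finite_moduli Q, h.finite_ballInt N,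
    fun f hf => h.finite_quotient (pow_ne_zero 2 hf.1), ?_⟩
  have hsum : 0 ≤ ∑ᶠ g ∈ SquareSieve.ballInt (F := F) v N, ‖a g‖ ^ 2 :=
    finsum_nonneg fun _ => finsum_nonneg fun _ => sq_nonneg _
  have hU : 0 ≤ (q : ℝ) ^ (3 * Q) := by positivity
  have hV : 0 ≤ (2 : ℝ) ^ (((N : ℝ) - (Q : ℝ)) / 2) *
      ((q : ℝ) ^ ((Q : ℝ) / 2 + (N : ℝ)) + (q : ℝ) ^ (2 * (Q : ℝ) + (N : ℝ) / 2)) := by positivity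
  have hC₁ : 0 ≤ (q : ℝ) ^ (d + 6) := by positivity
  have hC₂ : 0 ≤ (2 + (q : ℝ) ^ (d + 3) * 2 ^ q) * (q : ℝ) ^ (d + 4) := by positivity
  rcases le_total N (2 * Q) with hN | hN
  · refine (h.sieveSum_le_of_le hN a).trans (mul_le_mul_of_nonneg_right ?_ hsum)
    rw [hF, hd]
    exact mul_le_mul (by linarith) (by linarith) hU (by linarith)
  · refine (h.sieveSum_le_of_ge hN a).trans (mul_le_mul_of_nonneg_right ?_ hsum)
    rw [hF, hd]
    exact mul_le_mul (by linarith) (by linarith) hV (by linarith)
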